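/- **Setting.** Let $G$ be a (real, second countable) Lie group, $\Gamma\subset G$ a lattice, that is, a discrete subgroup such that $X=G/\Gamma$ carries a $G$-invariant Borel probability measure $\mu$. Fix a basis $Y_1,\dots,Y_n$ of the Lie algebra of $G$, acting on $C^\infty(X)$ by $(Yh)(x)=\frac{d}{ds}\big|_{s=0}h(\exp(sY)x)$. For $\ell\in\mathbb Z_+$ put $$\|h\|_{2,\ell}=\sum_{|\alpha|\le \ell}\|Y_1^{\alpha_1}\cdots Y_n^{\alpha_n}h\|_{L^2(X,\mu)},\qquad C_2^\infty(X)=\{h\in C^\infty(X):\|h\|_{2,\ell}<\infty\ \text{ for all }\ell\in\mathbb Z_+\}.$$ Fix a right-invariant Riemannian metric on $G$ and let $\|g\|$ be the distance from $g$ to the identity (it is $\infty$, and $e^{-\lambda\|g\|}=0$, if $g$ is not in the identity component). Write $(g\varphi)(x)=\varphi(g^{-1}x)$, let $\langle\cdot,\cdot\rangle$ be the inner product of $L^2(X,\mu)$, and let $\mathbb N=\{1,2,\dots\}$. The $G$-action on $X$ is *exponentially mixing* if there are $\lambda,E>0$ and $\ell\in\mathbb Z_+$ such that for all $\varphi,\psi\in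 C_2^\infty(X)$ and all $g\in G$ $$\Big|\langle g\varphi,\psi\rangle-\int_X\varphi\,d\mu\int_X\psi\,d\mu\Big|\le E\,e^{-\lambda\|g\|}\,\|\varphi\|_{2,\ell}\,\|\psi\|_{2,\ell}.\tag{EM}$$ A sequence $\{f_t:t\in\mathbb N\}$ in $G$ is *exponentially divergent* if $$\sup_{t\in\mathbb N}\sum_{s=1}^\infty e^{-\lambda\|f_sf_t^{-1}\|}<\infty\qquad\text{for all }\lambda>0.\tag{ED}$$ A function $\Delta:X\to\mathbb R$ is *DL* (distance-like) with threshold $z_0\in\mathbb R$ if, with $\Phi_\Delta(z)=\mu(\{x:\Delta(x)\ge z\})$, * $\Phi_\Delta(z_0)>0$; * for every $\varepsilon>0$ there is a neighborhood $U$ of the identity in $G$ such that $|\Delta(x)-\Delta(gx)|<\varepsilon$ for all $g\in U$ and all $x$ with $\Delta(x)\ge z_0$; * there are $c,\delta>0$ such that $\Phi_\Delta(z)\ge c\,\Phi_\Delta(z-\delta)$ for all $z\ge z_0$. A family $\mathcal B$ of subsets of $X$ is *Borel–Cantelli for $\{f_t\}$* if for every sequence $\{A_t:t\in\mathbb N\}$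 of members of $\mathcal B$ the set $\{x\in X: f_tx\in A_t\text{ for infinitely many }t\}$ is $\mu$-null if $\sum_t\mu(A_t)<\infty$ and $\mu$-conull if $\sum_t\mu(A_t)=\infty$. **Theorem 1.3.** Suppose that the $G$-action on $X$ is exponentially mixing. Let $\{f_t:t\in\mathbb N\}$ be a sequence of elements of $G$ satisfying (ED), and let $\Delta$ be a DL function on $X$ with threshold $z_0$. 1. If $\{r_t:t\in\mathbb N\}\subset[z_0,\infty)$ and $\sum_{t=1}^\infty\Phi_\Delta(r_t)=\infty$, then for some $0<c\le1$ and for $\mu$-almost all $x\in X$ $$c\le\liminf_{N\to\infty}\frac{\#\{1\le t\le N:\Delta(f_tx)\ge r_t\}}{\sum_{t=1}^N\Phi_\Delta(r_t)}\le\limsup_{N\to\infty}\frac{\#\{1\le t\le N:\Delta(f_tx)\ge r_t\}}{\sum_{t=1}^N\Phi_\Delta(r_t)}\le\frac1c.$$ 2. Consequently, for any real sequence $\{r_t\}$ with $\sum_{t=1}^\infty\Phi_\Delta(r_t)=\infty$ and $\mu$-almost all $x\in X$ one has $\Delta(f_tx)\ge r_t$ for infinitely many $t\in\mathbb N$. That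 is, the family of super-level sets $\{\Delta^{-1}([z,\infty)):z\in\mathbb R\}$ is Borel–Cantelli for $\{f_t\}$. -/

import Mathlib

open Set Filter Topology MeasureTheory Manifold Bundle
open scoped ENNReal ContDiff

namespace HomogeneousDynamics

noncomputable section

section Metric

variable {E : Type*} [NormedAddCommGroup E] [NormedSpace ℝ E]
  {G : Type*} [TopologicalSpace G] [ChartedSpace E G] [Group G] [LieGroup 𝓘(ℝ, E) ∞ G]

/-- A smooth Riemannian metric `m` on the Lie group `G` is right-invariant if every right
translation `x ↦ x * a` is an isometry for it. -/
def IsRightInvariant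
    (m : ContMDiffRiemannianMetric 𝓘(ℝ, E) ∞ E (fun x : G => TangentSpace 𝓘(ℝ, E) x)) : Prop :=
  ∀ (a g : G) (v w : TangentSpace 𝓘(ℝ, E) g),
    m.inner (g * a)
        (mfderiv 𝓘(ℝ, E) 𝓘(ℝ, E) (fun x : G => x * a) g v)
        (mfderiv 𝓘(ℝ, E) 𝓘(ℝ, E) (fun x : G => x * a) g w)
      = m.inner g v w

/-- `‖g‖`: the Riemannian distance between `g` and the identity element, that is, the infimum of
the `m`-lengths of the `C^1` paths joining them (it is `⊤` if `g` lies outside the identity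
component). -/
def gnorm (m : ContMDiffRiemannianMetric 𝓘(ℝ, E) ∞ E (fun x : G => TangentSpace 𝓘(ℝ, E) x))
    (g : G) : ℝ≥0∞ :=
  letI : RiemannianBundle (fun x : G => TangentSpace 𝓘(ℝ, E) x) := ⟨m.toRiemannianMetric⟩
  riemannianEDist 𝓘(ℝ, E) g 1

/-- `e^{-lam * d}` for a distance `d ∈ [0, ∞]`, with `e^{-∞} = 0`. -/
def expNeg (lam : ℝ) (d : ℝ≥0∞) : ℝ≥0∞ :=
  if d = ⊤ then 0 else ENNReal.ofReal (Real.exp (-lam * d.toReal))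

/-- Exponential divergence of a sequence `f_1, f_2, …` in `G`. -/
def ExponentiallyDivergent
    (m : ContMDiffRiemannianMetric 𝓘(ℝ, E) ∞ E (fun x : G => TangentSpace 𝓘(ℝ, E) x))
    (f : ℕ+ → G) : Prop :=
  ∀ lam : ℝ, 0 < lam → ⨆ t : ℕ+, ∑' s : ℕ+, expNeg lam (gnorm m (f s * (f t)⁻¹)) < ⊤

end Metric

section Sobolev

variable {E : Type*} [NormedAddCommGroup E] [NormedSpace ℝ E]
  {G : Type*} [TopologicalSpace G] [ChartedSpace E G] [Group G] {Γ : Subgroup G}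

/-- Smoothness of a function on `X = G ⧸ Γ`, for `Γ` discrete: since the projection `G → X` is a
local diffeomorphism, `h` is smooth iff its lift to `G` is. -/
def IsSmooth (h : G ⧸ Γ → ℝ) : Prop :=
  ContMDiff 𝓘(ℝ, E) 𝓘(ℝ, ℝ) ∞ (fun g : G => h (g : G ⧸ Γ))

/-- The first order differential operator on `X = G ⧸ Γ` given by `Y` in the Lie algebra of `G`
(the tangent space at `1`): `(Y h)(x)` is the derivative at `a = 1`, in the direction `Y`, of
`a ↦ h (a x)`; for smooth `h` this is the derivative at `s = 0` of `h (exp (s Y) x)`. -/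
def lieD (Y : GroupLieAlgebra 𝓘(ℝ, E) G) (h : G ⧸ Γ → ℝ) (x : G ⧸ Γ) : ℝ :=
  mfderiv 𝓘(ℝ, E) 𝓘(ℝ, ℝ) (fun a : G => h (a • x)) 1 Y

variable {n : ℕ}

/-- `D^α = Y_1^{α_1} ⋯ Y_n^{α_n}`, as a composition of differential operators. -/
def multiD (Y : Fin n → GroupLieAlgebra 𝓘(ℝ, E) G) (α : Fin n → ℕ) (h : G ⧸ Γ → ℝ) :
    G ⧸ Γ → ℝ :=
  (List.finRange n).foldr (fun i u => (lieD (Y i))^[α i] u) h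

variable [MeasurableSpace (G ⧸ Γ)]

/-- The `L^2`, order `l` Sobolev norm: the sum of `‖D^α h‖_2` over the multiindices
`α = (α_1, …, α_n)` with `|α| ≤ l`. -/
def sobolevNorm (μ : Measure (G ⧸ Γ)) (Y : Fin n → GroupLieAlgebra 𝓘(ℝ, E) G) (l : ℕ)
    (h : G ⧸ Γ → ℝ) : ℝ≥0∞ :=
  ∑ α ∈ (Fintype.piFinset fun _ : Fin n => Finset.range (l + 1)) with ∑ i, α i ≤ l,
    eLpNorm (multiD Y α h) 2 μ

/-- The space `C^∞_2(X)` of smooth functions all of whose Sobolev norms are finite. -/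
def CInftyTwo (μ : Measure (G ⧸ Γ)) (Y : Fin n → GroupLieAlgebra 𝓘(ℝ, E) G) :
    Set (G ⧸ Γ → ℝ) :=
  {h | IsSmooth (E := E) h ∧ ∀ l : ℕ, sobolevNorm μ Y l h < ⊤}

/-- Exponential mixing of the `G`-action on `X = G ⧸ Γ`, where `(g φ)(x) = φ (g⁻¹ x)`. -/
def ExponentiallyMixing [LieGroup 𝓘(ℝ, E) ∞ G] (μ : Measure (G ⧸ Γ))
    (Y : Fin n → GroupLieAlgebra 𝓘(ℝ, E) G)
    (m : ContMDiffRiemannianMetric 𝓘(ℝ, E) ∞ E (fun x : G => TangentSpace 𝓘(ℝ, E) x)) : Prop :=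
  ∃ lam C : ℝ, ∃ l : ℕ, 0 < lam ∧ 0 < C ∧
    ∀ φ ∈ CInftyTwo μ Y, ∀ ψ ∈ CInftyTwo μ Y, ∀ g : G,
      ENNReal.ofReal |(∫ x, φ (g⁻¹ • x) * ψ x ∂μ) - (∫ x, φ x ∂μ) * ∫ x, ψ x ∂μ| ≤
        ENNReal.ofReal C * expNeg lam (gnorm m g) * sobolevNorm μ Y l φ * sobolevNorm μ Y l ψ

end Sobolev

section Excursions

variable {G : Type*} [Group G] {Γ : Subgroup G} [MeasurableSpace (G ⧸ Γ)]

/-- The super-level set `Δ⁻¹([z, ∞))`. -/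
def superLevel (Δ : G ⧸ Γ → ℝ) (z : ℝ) : Set (G ⧸ Γ) := {x | z ≤ Δ x}

/-- `Δ` is a distance-like function on `X = G ⧸ Γ`, with `z₀` as the threshold in the definition. -/
def IsDL [TopologicalSpace G] (μ : Measure (G ⧸ Γ)) (Δ : G ⧸ Γ → ℝ) (z₀ : ℝ) : Prop :=
  0 < μ (superLevel Δ z₀) ∧
  (∀ ε > 0, ∃ U ∈ 𝓝 (1 : G), ∀ x : G ⧸ Γ, z₀ ≤ Δ x → ∀ g ∈ U, |Δ x - Δ (g • x)| < ε) ∧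
  ∃ c δ : ℝ, 0 < c ∧ 0 < δ ∧
    ∀ z ≥ z₀, ENNReal.ofReal c * μ (superLevel Δ (z - δ)) ≤ μ (superLevel Δ z)

/-- A family `B` of subsets of `X` is Borel–Cantelli for `f_1, f_2, …` if for every sequence
`A_1, A_2, …` of members of `B`, the set of `x` with `f_t x ∈ A_t` for infinitely many `t` is
null or conull according to whether `∑ μ(A_t)` converges or diverges. -/
def IsBorelCantelli (μ : Measure (G ⧸ Γ)) (f : ℕ+ → G) (B : Set (Set (G ⧸ Γ))) : Prop :=
  ∀ A : ℕ+ → Set (G ⧸ Γ), (∀ t, A t ∈ B) →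
    (∑' t, μ (A t) < ⊤ → ∀ᵐ x ∂μ, ¬ {t : ℕ+ | f t • x ∈ A t}.Infinite) ∧
    (∑' t, μ (A t) = ⊤ → ∀ᵐ x ∂μ, {t : ℕ+ | f t • x ∈ A t}.Infinite)

/-- `#{1 ≤ t ≤ N | Δ (f_t x) ≥ r_t}` divided by `∑_{t=1}^N μ(Δ ≥ r_t)`, in `[0, ∞]`. -/
def excursionRatio (μ : Measure (G ⧸ Γ)) (Δ : G ⧸ Γ → ℝ) (f : ℕ+ → G) (r : ℕ+ → ℝ)
    (x : G ⧸ Γ) (N : ℕ+) : ℝ≥0∞ :=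
  ({t : ℕ+ | t ≤ N ∧ r t ≤ Δ (f t • x)}.ncard : ℝ≥0∞) /
    ∑ t ∈ Finset.Icc 1 N, μ (superLevel Δ (r t))

end Excursions

end

end HomogeneousDynamics

/-!
# Borel–Cantelli for superlevel sets of distance-like functions

A second moment argument. If `h t` are functions on `X = G ⧸ Γ` with values in `[0, 1]` and means
`a t`, and if the covariance of `h s ∘ f s` and `h t ∘ f t` is at most `e s t * √(a s * a t)` for a
matrix `e` with bounded column sums, then by Schur's test the variance of `∑ t ≤ N, h t ∘ f t` is at
most a multiple of its mean `∑ t ≤ N, a t` (`integral_sum_sub_sq_le`). When the means diverge, this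
makes the sum almost surely comparable to its mean (`ae_eventually_comparable`): along
times at which the mean grows geometrically the normalized second moments are summable, and in
between one interpolates by monotonicity.

Exponential mixing and exponential divergence provide such a matrix, `e s t` being a multiple of
`exp (-λ ‖f s (f t)⁻¹‖)`, as soon as the Sobolev norms of the `h t` are at most a multiple of
`√(a t)`. This holds for convolutions `h = ψ * 1_W` with a fixed smooth mollifier `ψ` on `G` of
integral one: an invariant differential operator falls on `ψ` (`lieD_smear`), and
`‖ψ' * 1_W‖₂ ≤ ‖ψ'‖₁ μ(W)^(1/2)` (`eLpNorm_smear_le`), while the mean of `h` is `μ(W)`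
(`integral_smear`).

Finally the indicator of `A z = {Δ ≥ z}` lies between two functions of this form whose means are
comparable to `μ (A z)`. Let `ψ` be supported in a small symmetric neighbourhood `U` of `1`. By
uniform continuity, `U • A z` is contained in `A (z - δ)`, whose measure is at most a multiple of
that of `A z`, and `ψ * 1_{U • A z}` is a majorant; `ψ * 1_{U • A (z + δ)}` is a minorant, and its
mean is at least `μ (A (z + δ)) ≥ c μ (A z)` (`exists_ae_eventually_count_comparable`).
-/

namespace HomogeneousDynamics

/-! ### Smoothness of parametric integrals -/

section ParametricIntegral

variable {E : Type*} [NormedAddCommGroup E] [NormedSpace ℝ E]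
  {G : Type*} [TopologicalSpace G] [ChartedSpace E G]
  {K : E → G → ℝ} {V : Set E}

theorem fderiv_left_eq_zero {G : Type*} {K : E → G → ℝ} (hV : IsOpen V) {C : Set G}
    (hKC : ∀ e ∈ V, ∀ g ∉ C, K e g = 0) {e : E} (he : e ∈ V) {g : G} (hg : g ∉ C) :
    fderiv ℝ (fun e => K e g) e = 0 := by
  have : (fun e => K e g) =ᶠ[𝓝 e] fun _ => 0 :=
    (hV.eventually_mem he).mono fun e' he' => hKC e' he' g hg
  rw [this.fderiv_eq]
  simp

theorem differentiableAt_left (hV : IsOpen V)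
    (hK : ContMDiffOn (𝓘(ℝ, E).prod 𝓘(ℝ, E)) 𝓘(ℝ, ℝ) ∞ (Function.uncurry K) (V ×ˢ univ))
    {e : E} (he : e ∈ V) (g : G) : DifferentiableAt ℝ (fun e => K e g) e := by
  have h1 : ContMDiffAt 𝓘(ℝ, E) 𝓘(ℝ, ℝ) ∞ (fun e => K e g) e :=
    ContMDiffAt.comp e (g := Function.uncurry K) (f := fun e => (e, g))
      (hK.contMDiffAt ((hV.prod isOpen_univ).mem_nhds ⟨he, mem_univ g⟩))
      (contMDiffAt_id.prodMk contMDiffAt_const)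
  exact h1.contDiffAt.differentiableAt (by simp)

variable [IsManifold 𝓘(ℝ, E) ∞ G]

theorem contMDiffOn_fderiv_left (hV : IsOpen V)
    (hK : ContMDiffOn (𝓘(ℝ, E).prod 𝓘(ℝ, E)) 𝓘(ℝ, ℝ) ∞ (Function.uncurry K) (V ×ˢ univ)) :
    ContMDiffOn (𝓘(ℝ, E).prod 𝓘(ℝ, E)) 𝓘(ℝ, E →L[ℝ] ℝ) ∞
      (fun p : E × G => fderiv ℝ (fun e => K e p.2) p.1) (V ×ˢ univ) := by
  rintro ⟨e, g⟩ he
  have hKat : ContMDiffAt (𝓘(ℝ, E).prod 𝓘(ℝ, E)) 𝓘(ℝ, ℝ) ∞ (Function.uncurry K) (e, g) :=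
    hK.contMDiffAt ((hV.prod isOpen_univ).mem_nhds he)
  have h1 : ContMDiffAt ((𝓘(ℝ, E).prod 𝓘(ℝ, E)).prod 𝓘(ℝ, E)) 𝓘(ℝ, ℝ) ∞
      (Function.uncurry fun (p : E × G) (e' : E) => K e' p.2) ((e, g), e) :=
    ContMDiffAt.comp ((e, g), e) (g := Function.uncurry K)
      (f := fun q : (E × G) × E => (q.2, q.1.2)) hKat
      (contMDiffAt_snd.prodMk contMDiffAt_fst.snd)
  have h2 := ContMDiffAt.mfderiv (I := 𝓘(ℝ, E)) (I' := 𝓘(ℝ, ℝ)) (m := ∞)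
    (fun (p : E × G) (e' : E) => K e' p.2) (fun p => p.1) h1 contMDiffAt_fst (by simp)
  refine (h2.congr_of_eventuallyEq (.of_forall fun p => ?_)).contMDiffWithinAt
  have h3 := congrFun (inTangentCoordinates_model_space (I := 𝓘(ℝ, E)) (I' := 𝓘(ℝ, ℝ))
    (fun p : E × G => p.1) (fun p : E × G => K p.1 p.2)
    (fun p => mfderiv 𝓘(ℝ, E) 𝓘(ℝ, ℝ) (fun e' => K e' p.2) p.1) (e, g)) p
  exact (h3.trans mfderiv_eq_fderiv).symm

theorem contMDiffOn_fderiv_left_apply (hV : IsOpen V)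
    (hK : ContMDiffOn (𝓘(ℝ, E).prod 𝓘(ℝ, E)) 𝓘(ℝ, ℝ) ∞ (Function.uncurry K) (V ×ˢ univ))
    (v : E) :
    ContMDiffOn (𝓘(ℝ, E).prod 𝓘(ℝ, E)) 𝓘(ℝ, ℝ) ∞
      (Function.uncurry fun (e : E) (g : G) => fderiv ℝ (fun e => K e g) e v) (V ×ˢ univ) :=
  (contMDiffOn_fderiv_left hV hK).clm_apply contMDiffOn_const

theorem continuous_fderiv_left (hV : IsOpen V)
    (hK : ContMDiffOn (𝓘(ℝ, E).prod 𝓘(ℝ, E)) 𝓘(ℝ, ℝ) ∞ (Function.uncurry K) (V ×ˢ univ))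
    {e : E} (he : e ∈ V) : Continuous fun g => fderiv ℝ (fun e => K e g) e := by
  rw [← continuousOn_univ]
  exact (contMDiffOn_fderiv_left hV hK).continuousOn.comp (f := fun g => (e, g)) (by fun_prop)
    fun g _ => ⟨he, mem_univ g⟩

variable [MeasurableSpace G] [BorelSpace G] [T2Space G]
  {ν : Measure G} [IsFiniteMeasureOnCompacts ν] {C : Set G} {F : G → ℝ}

/-- Differentiation under the integral sign: the compact set `C` carries the integrand for all
parameters, so a locally uniform bound on the derivative of the kernel is a domination. -/
theorem hasFDerivAt_integral_left [FiniteDimensional ℝ E] (hV : IsOpen V)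
    (hK : ContMDiffOn (𝓘(ℝ, E).prod 𝓘(ℝ, E)) 𝓘(ℝ, ℝ) ∞ (Function.uncurry K) (V ×ˢ univ))
    (hC : IsCompact C) (hKC : ∀ e ∈ V, ∀ g ∉ C, K e g = 0)
    (hF : Measurable F) (hF1 : ∀ g, |F g| ≤ 1) {e₀ : E} (he₀ : e₀ ∈ V) :
    HasFDerivAt (fun e => ∫ g, K e g * F g ∂ν)
      (∫ g, F g • fderiv ℝ (fun e => K e g) e₀ ∂ν) e₀ := by
  obtain ⟨B, hB, hBV, hBc⟩ : ∃ B ∈ 𝓝 e₀, B ⊆ V ∧ IsCompact B :=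
    have : ProperSpace E := FiniteDimensional.proper ℝ E
    local_compact_nhds (hV.mem_nhds he₀)
  have hD := (contMDiffOn_fderiv_left hV hK).continuousOn
  have hcont : ∀ e ∈ V, Continuous (K e) := fun e he => by
    rw [← continuousOn_univ]
    exact hK.continuousOn.comp (f := fun g => (e, g)) (by fun_prop) fun g _ => ⟨he, mem_univ g⟩
  have hDcont := continuous_fderiv_left hV hK he₀
  obtain ⟨M, hM⟩ := (hBc.prod hC).exists_bound_of_continuousOn
    (hD.mono (prod_mono hBV (subset_univ C)))
  have hmeas : ∀ e ∈ V, AEStronglyMeasurable (fun g => K e g * F g) ν := fun e he =>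
    ((hcont e he).measurable.mul hF).aestronglyMeasurable
  refine hasFDerivAt_integral_of_dominated_of_fderiv_le (𝕜 := ℝ) (s := B)
    (F' := fun e g => F g • fderiv ℝ (fun e => K e g) e) (bound := C.indicator fun _ => M)
    hB ?_ ?_ ?_ ?_ ?_ ?_
  · exact (hV.eventually_mem he₀).mono hmeas
  · have h1 : Integrable (K e₀) ν := (hcont e₀ he₀).integrable_of_hasCompactSupport
      (HasCompactSupport.intro hC fun g hg => hKC e₀ he₀ g hg)
    exact h1.mono (hmeas e₀ he₀) (ae_of_all _ fun g => by
      rw [norm_mul]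
      exact mul_le_of_le_one_right (norm_nonneg _) (hF1 g))
  · exact (hF.stronglyMeasurable.smul hDcont.stronglyMeasurable).aestronglyMeasurable
  · refine ae_of_all _ fun g e he => ?_
    by_cases hg : g ∈ C
    · rw [indicator_of_mem hg, norm_smul]
      exact (mul_le_of_le_one_left (norm_nonneg _) (hF1 g)).trans (hM (e, g) ⟨he, hg⟩)
    · simp [fderiv_left_eq_zero hV hKC (hBV he) hg, hg]
  · exact (integrable_indicator_iff hC.measurableSet).2
      (integrableOn_const (hs := hC.measure_lt_top.ne))
  · refine ae_of_all _ fun g e he => ?_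
    have := (differentiableAt_left hV hK (hBV he) g).hasFDerivAt.const_mul (F g)
    simpa only [mul_comm] using this

theorem fderiv_integral_left_apply [FiniteDimensional ℝ E] (hV : IsOpen V)
    (hK : ContMDiffOn (𝓘(ℝ, E).prod 𝓘(ℝ, E)) 𝓘(ℝ, ℝ) ∞ (Function.uncurry K) (V ×ˢ univ))
    (hC : IsCompact C) (hKC : ∀ e ∈ V, ∀ g ∉ C, K e g = 0)
    (hF : Measurable F) (hF1 : ∀ g, |F g| ≤ 1) {e₀ : E} (he₀ : e₀ ∈ V) (v : E) :
    fderiv ℝ (fun e => ∫ g, K e g * F g ∂ν) e₀ v =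
      ∫ g, fderiv ℝ (fun e => K e g) e₀ v * F g ∂ν := by
  rw [(hasFDerivAt_integral_left hV hK hC hKC hF hF1 he₀).fderiv]
  have hDcont := continuous_fderiv_left hV hK he₀
  have hint : Integrable (fun g => F g • fderiv ℝ (fun e => K e g) e₀) ν := by
    have h1 : Integrable (fun g => fderiv ℝ (fun e => K e g) e₀) ν :=
      hDcont.integrable_of_hasCompactSupport
        (HasCompactSupport.intro hC fun g hg => fderiv_left_eq_zero hV hKC he₀ hg)
    exact h1.mono (hF.stronglyMeasurable.smul hDcont.stronglyMeasurable).aestronglyMeasurable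
      (ae_of_all _ fun g => by
        rw [norm_smul]
        exact mul_le_of_le_one_left (norm_nonneg _) (hF1 g))
  rw [ContinuousLinearMap.integral_apply hint]
  exact integral_congr_ae (ae_of_all _ fun g => by simp [mul_comm])

/-- The integral of a smooth kernel against a bounded function depends smoothly on the parameter.
The induction runs over all kernels at once, since the directional derivatives of an admissible
kernel are again admissible kernels. -/
theorem contDiffOn_integral_left [FiniteDimensional ℝ E] (hV : IsOpen V)
    (hK : ContMDiffOn (𝓘(ℝ, E).prod 𝓘(ℝ, E)) 𝓘(ℝ, ℝ) ∞ (Function.uncurry K) (V ×ˢ univ))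
    (hC : IsCompact C) (hKC : ∀ e ∈ V, ∀ g ∉ C, K e g = 0)
    (hF : Measurable F) (hF1 : ∀ g, |F g| ≤ 1) :
    ContDiffOn ℝ ∞ (fun e => ∫ g, K e g * F g ∂ν) V := by
  rw [contDiffOn_infty]
  intro n
  induction n generalizing K with
  | zero =>
    refine contDiffOn_zero.2 fun e he => ?_
    exact (hasFDerivAt_integral_left hV hK hC hKC hF hF1 he).continuousAt.continuousWithinAt
  | succ n ih =>
    push_cast
    refine contDiffOn_succ_of_fderiv_apply (fun e he => ?_) (fun h => ?_) fun v => ?_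
    · exact (hasFDerivAt_integral_left hV hK hC hKC hF
        hF1 he).differentiableAt.differentiableWithinAt
    · simp at h
    · have h0 : ∀ e ∈ V, ∀ g ∉ C, fderiv ℝ (fun e => K e g) e v = 0 := fun e he g hg => by
        simp [fderiv_left_eq_zero hV hKC he hg]
      refine (ih (contMDiffOn_fderiv_left_apply hV hK v) h0).congr fun e he => ?_
      rw [fderivWithin_of_isOpen hV he]
      exact fderiv_integral_left_apply hV hK hC hKC hF hF1 he v

end ParametricIntegral

/-! ### Smooth kernels on the Lie group -/

/-- The manifold derivative at `1` is by definition computed in the chart at `1`. -/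
theorem mfderiv_one_eq_fderiv {E G : Type*} [NormedAddCommGroup E] [NormedSpace ℝ E]
    [TopologicalSpace G] [ChartedSpace E G] [Group G] {u : G → ℝ}
    (hu : ContMDiff 𝓘(ℝ, E) 𝓘(ℝ, ℝ) ∞ u)
    (Y : GroupLieAlgebra 𝓘(ℝ, E) G) :
    mfderiv 𝓘(ℝ, E) 𝓘(ℝ, ℝ) u 1 Y =
      fderiv ℝ (fun e => u ((extChartAt 𝓘(ℝ, E) (1 : G)).symm e))
        (extChartAt 𝓘(ℝ, E) (1 : G) 1) (Y : E) := by
  have hd : MDifferentiableAt 𝓘(ℝ, E) 𝓘(ℝ, ℝ) u 1 := hu.mdifferentiable (by simp) 1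
  have h2 : fderivWithin ℝ (fun e => u ((extChartAt 𝓘(ℝ, E) (1 : G)).symm e))
      (range 𝓘(ℝ, E)) (extChartAt 𝓘(ℝ, E) (1 : G) 1) =
      fderiv ℝ (fun e => u ((extChartAt 𝓘(ℝ, E) (1 : G)).symm e))
        (extChartAt 𝓘(ℝ, E) (1 : G) 1) := by
    rw [ModelWithCorners.range_eq_univ, fderivWithin_univ]
  exact DFunLike.congr_fun (hd.mfderiv.trans h2) Y

section LieGroupKernels

open scoped Pointwise

variable {E : Type*} [NormedAddCommGroup E] [NormedSpace ℝ E]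
  {G : Type*} [TopologicalSpace G] [ChartedSpace E G] [Group G] [LieGroup 𝓘(ℝ, E) ∞ G]
  {ψ : G → ℝ}

variable (E) in
/-- The test functions on `G`: smooth, with compact support. -/
def IsTest (ψ : G → ℝ) : Prop := ContMDiff 𝓘(ℝ, E) 𝓘(ℝ, ℝ) ∞ ψ ∧ HasCompactSupport ψ

/-- The derivative of `ψ` along the right-invariant vector field with value `Y` at `1`. -/
noncomputable def rightInvD (Y : GroupLieAlgebra 𝓘(ℝ, E) G) (ψ : G → ℝ) (g : G) : ℝ :=
  mfderiv 𝓘(ℝ, E) 𝓘(ℝ, ℝ) (fun a : G => ψ (a * g)) 1 Y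

theorem IsTest.contMDiff_mul (h : IsTest E ψ) (g : G) :
    ContMDiff 𝓘(ℝ, E) 𝓘(ℝ, ℝ) ∞ fun a => ψ (a * g) :=
  h.1.comp (contMDiff_mul_right (I := 𝓘(ℝ, E)) (n := ∞))

/-- In a chart around `a₀`, the kernel `(a, g) ↦ ψ (a g)` is smooth and carried by one compact
set of `g`, for all `a` near `a₀`. -/
theorem IsTest.exists_chart_kernel [FiniteDimensional ℝ E] [IsTopologicalGroup G]
    (h : IsTest E ψ) (a₀ : G) :
    ∃ V : Set E, IsOpen V ∧ extChartAt 𝓘(ℝ, E) a₀ a₀ ∈ V ∧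
      ContMDiffOn (𝓘(ℝ, E).prod 𝓘(ℝ, E)) 𝓘(ℝ, ℝ) ∞
        (Function.uncurry fun (e : E) (g : G) => ψ ((extChartAt 𝓘(ℝ, E) a₀).symm e * g))
        (V ×ˢ univ) ∧
      ∃ C : Set G, IsCompact C ∧
        ∀ e ∈ V, ∀ g ∉ C, ψ ((extChartAt 𝓘(ℝ, E) a₀).symm e * g) = 0 := by
  have : ProperSpace E := FiniteDimensional.proper ℝ E
  set φ := extChartAt 𝓘(ℝ, E) a₀ with hφ
  obtain ⟨B, hB, hBV, hBc⟩ : ∃ B ∈ 𝓝 (φ a₀), B ⊆ φ.target ∧ IsCompact B :=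
    local_compact_nhds ((isOpen_extChartAt_target a₀).mem_nhds (mem_extChartAt_target a₀))
  refine ⟨interior B, isOpen_interior, mem_interior_iff_mem_nhds.2 hB, ?_,
    (φ.symm '' B)⁻¹ * tsupport ψ, ?_, ?_⟩
  · refine h.1.comp_contMDiffOn (ContMDiffOn.mul ?_ contMDiffOn_snd)
    exact (contMDiffOn_extChartAt_symm a₀).comp contMDiffOn_fst
      fun p hp => hBV (interior_subset hp.1)
  · exact (hBc.image_of_continuousOn ((continuousOn_extChartAt_symm a₀).mono hBV)).inv.mul h.2
  · intro e he g hg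
    by_contra hne
    refine hg ⟨(φ.symm e)⁻¹, ?_, φ.symm e * g, subset_tsupport _ hne, by simp⟩
    exact inv_mem_inv.2 (mem_image_of_mem _ (interior_subset he))

variable [FiniteDimensional ℝ E] [IsTopologicalGroup G]

theorem IsTest.rightInvD (h : IsTest E ψ) (Y : GroupLieAlgebra 𝓘(ℝ, E) G) :
    IsTest E (rightInvD Y ψ) := by
  constructor
  · obtain ⟨V, hV, ha₀, hK, -⟩ := h.exists_chart_kernel (1 : G)
    have h1 := (contMDiffOn_fderiv_left_apply hV hK (Y : E)).comp_contMDiff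
      (f := fun g : G => (extChartAt 𝓘(ℝ, E) (1 : G) 1, g))
      (contMDiff_const.prodMk contMDiff_id) fun g => ⟨ha₀, mem_univ g⟩
    have h2 : HomogeneousDynamics.rightInvD Y ψ = fun g : G => fderiv ℝ
        (fun e => ψ ((extChartAt 𝓘(ℝ, E) (1 : G)).symm e * g))
        (extChartAt 𝓘(ℝ, E) (1 : G) 1) (Y : E) :=
      funext fun g => mfderiv_one_eq_fderiv (h.contMDiff_mul g) Y
    rw [h2]
    exact h1
  · refine HasCompactSupport.intro h.2 fun g hg => ?_
    have h1 : (fun a : G => ψ (a * g)) =ᶠ[𝓝 1] fun _ => 0 := by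
      have h2 : Tendsto (fun a : G => a * g) (𝓝 1) (𝓝 g) := by
        simpa using (continuous_mul_const g).tendsto 1
      filter_upwards [h2.eventually ((isClosed_tsupport ψ).isOpen_compl.eventually_mem hg)]
        with a ha using image_eq_zero_of_notMem_tsupport ha
    have h3 := h1.mfderiv_eq (I := 𝓘(ℝ, E)) (I' := 𝓘(ℝ, ℝ))
    rw [mfderiv_const] at h3
    exact DFunLike.congr_fun h3 Y

variable [MeasurableSpace G] [T2Space G]
  [BorelSpace G] {ν : Measure G} [IsFiniteMeasureOnCompacts ν] {F : G → ℝ}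

theorem IsTest.contMDiff_integral (h : IsTest E ψ) (hF : Measurable F) (hF1 : ∀ g, |F g| ≤ 1) :
    ContMDiff 𝓘(ℝ, E) 𝓘(ℝ, ℝ) ∞ fun a => ∫ g, ψ (a * g) * F g ∂ν := by
  intro a₀
  obtain ⟨V, hV, ha₀, hK, C, hC, hKC⟩ := h.exists_chart_kernel a₀
  have h1 := (contDiffOn_integral_left (ν := ν) hV hK hC hKC hF hF1).contDiffAt
    (hV.mem_nhds ha₀)
  refine (h1.contMDiffAt.comp a₀ (contMDiffAt_extChartAt (n := ∞))).congr_of_eventuallyEq ?_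
  filter_upwards [extChartAt_source_mem_nhds (I := 𝓘(ℝ, E)) a₀] with a ha
  simp only [Function.comp]
  rw [(extChartAt 𝓘(ℝ, E) a₀).left_inv ha]

theorem IsTest.mfderiv_integral (h : IsTest E ψ) (hF : Measurable F) (hF1 : ∀ g, |F g| ≤ 1)
    (Y : GroupLieAlgebra 𝓘(ℝ, E) G) :
    mfderiv 𝓘(ℝ, E) 𝓘(ℝ, ℝ) (fun a => ∫ g, ψ (a * g) * F g ∂ν) 1 Y =
      ∫ g, HomogeneousDynamics.rightInvD Y ψ g * F g ∂ν := by
  obtain ⟨V, hV, ha₀, hK, C, hC, hKC⟩ := h.exists_chart_kernel (1 : G)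
  rw [mfderiv_one_eq_fderiv (h.contMDiff_integral hF hF1)]
  refine (fderiv_integral_left_apply (ν := ν) hV hK hC hKC hF hF1 ha₀ Y).trans ?_
  refine integral_congr_ae (ae_of_all _ fun g => ?_)
  simp only [HomogeneousDynamics.rightInvD]
  rw [mfderiv_one_eq_fderiv (h.contMDiff_mul g)]

end LieGroupKernels

/-! ### Smoothing indicator functions on the homogeneous space -/

theorem abs_indicator_one_le {X : Type*} {W : Set X} (y : X) :
    |W.indicator (1 : X → ℝ) y| ≤ 1 := by
  by_cases h : y ∈ W <;> simp [h]

section Smear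

variable {G : Type*} [Group G] {Γ : Subgroup G} [MeasurableSpace G]

/-- The convolution `ψ * 1_W` of a function `ψ` on `G` with the indicator function of `W ⊆ G ⧸ Γ`,
with respect to a measure `ν` on `G`. -/
noncomputable def smear (ν : Measure G) (ψ : G → ℝ) (W : Set (G ⧸ Γ)) (x : G ⧸ Γ) : ℝ :=
  ∫ g, ψ g * W.indicator 1 (g⁻¹ • x) ∂ν

variable {ν : Measure G} {ψ : G → ℝ} {W : Set (G ⧸ Γ)} {x : G ⧸ Γ}

theorem smear_nonneg (hψ : ∀ g, 0 ≤ ψ g) : 0 ≤ smear ν ψ W x :=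
  integral_nonneg fun g => mul_nonneg (hψ g) (indicator_nonneg (by simp) _)

theorem smear_le_one (hψ : ∀ g, 0 ≤ ψ g) (h1 : ∫ g, ψ g ∂ν = 1) : smear ν ψ W x ≤ 1 := by
  rw [← h1]
  refine integral_mono_of_nonneg
    (ae_of_all _ fun g => mul_nonneg (hψ g) (indicator_nonneg (by simp) _)) ?_
    (ae_of_all _ fun g => ?_)
  · by_contra h
    simp [integral_undef h] at h1
  · exact mul_le_of_le_one_right (hψ g) ((le_abs_self _).trans (abs_indicator_one_le _))

theorem smear_eq_one (h1 : ∫ g, ψ g ∂ν = 1) (h : ∀ g, ψ g ≠ 0 → g⁻¹ • x ∈ W) :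
    smear ν ψ W x = 1 := by
  rw [← h1]
  refine integral_congr_ae (ae_of_all _ fun g => ?_)
  by_cases hg : ψ g = 0
  · simp [hg]
  · simp [h g hg]

theorem smear_eq_zero (h : ∀ g, ψ g ≠ 0 → g⁻¹ • x ∉ W) : smear ν ψ W x = 0 := by
  refine (integral_congr_ae (g := fun _ => 0) (ae_of_all _ fun g => ?_)).trans (by simp)
  by_cases hg : ψ g = 0
  · simp [hg]
  · simp [h g hg]

/-- Translating the argument of `ψ * 1_W` amounts to translating `ψ`. -/
theorem smear_smul [MeasurableMul G] [ν.IsMulLeftInvariant] (a : G) :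
    smear ν ψ W (a • x) = ∫ g, ψ (a * g) * W.indicator 1 (g⁻¹ • x) ∂ν := by
  rw [smear, ← integral_mul_left_eq_self _ a]
  simp [← mul_smul]

end Smear

theorem IsTest.integrable {E G : Type*} [NormedAddCommGroup E] [NormedSpace ℝ E]
    [TopologicalSpace G] [ChartedSpace E G] [MeasurableSpace G] [BorelSpace G] [R1Space G]
    {ν : Measure G} [IsFiniteMeasureOnCompacts ν] {ψ : G → ℝ} (h : IsTest E ψ) :
    Integrable ψ ν :=
  h.1.continuous.integrable_of_hasCompactSupport h.2

/-- A nonnegative mollifier of integral one with support in a given neighbourhood of `1`. -/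
theorem exists_mollifier {E : Type*} [NormedAddCommGroup E] [NormedSpace ℝ E]
    [FiniteDimensional ℝ E] {G : Type*} [TopologicalSpace G] [T2Space G] [ChartedSpace E G]
    [Group G] [LieGroup 𝓘(ℝ, E) ∞ G] [MeasurableSpace G] [BorelSpace G] (ν : Measure G)
    [IsFiniteMeasureOnCompacts ν] [ν.IsOpenPosMeasure]
    {U : Set G} (hU : U ∈ 𝓝 (1 : G)) :
    ∃ ψ : G → ℝ, IsTest E ψ ∧ (∀ g, 0 ≤ ψ g) ∧ ∫ g, ψ g ∂ν = 1 ∧ ∀ g, ψ g ≠ 0 → g ∈ U := by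
  obtain ⟨b, -, hb⟩ := (SmoothBumpFunction.nhds_basis_tsupport (I := 𝓘(ℝ, E))
    (1 : G)).mem_iff.1 hU
  have hpos : 0 < ∫ g, b g ∂ν :=
    b.continuous.integral_pos_of_hasCompactSupport_nonneg_nonzero b.hasCompactSupport
      (fun g => b.nonneg) (x := 1) (by simp)
  refine ⟨fun g => (∫ g, b g ∂ν)⁻¹ * b g, ⟨contMDiff_const.mul b.contMDiff,
    b.hasCompactSupport.mul_left⟩, fun g => mul_nonneg (inv_nonneg.2 hpos.le) b.nonneg, ?_, ?_⟩
  · rw [integral_const_mul, inv_mul_cancel₀ hpos.ne']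
  · exact fun g hg => hb (subset_tsupport _ (right_ne_zero_of_mul hg))

section SmearMeasure

variable {E : Type*} [NormedAddCommGroup E] [NormedSpace ℝ E]
  {G : Type*} [TopologicalSpace G] [SecondCountableTopology G]
  [ChartedSpace E G] [Group G] [IsTopologicalGroup G]
  [MeasurableSpace G] [BorelSpace G] {Γ : Subgroup G}
  [MeasurableSpace (G ⧸ Γ)] [BorelSpace (G ⧸ Γ)]
  {ν : Measure G} [IsFiniteMeasureOnCompacts ν] [SFinite ν]
  {ψ : G → ℝ} {W : Set (G ⧸ Γ)}

theorem measurable_inv_smul_fst : Measurable fun p : (G ⧸ Γ) × G => p.2⁻¹ • p.1 :=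
  (continuous_snd.inv.smul continuous_fst).measurable

theorem measurable_indicator_inv_smul (hW : MeasurableSet W) :
    Measurable fun p : (G ⧸ Γ) × G => W.indicator (1 : G ⧸ Γ → ℝ) (p.2⁻¹ • p.1) :=
  (measurable_one.indicator hW).comp
    measurable_inv_smul_fst

theorem measurable_indicator_inv_smul_right (hW : MeasurableSet W) (x : G ⧸ Γ) :
    Measurable fun g : G => W.indicator (1 : G ⧸ Γ → ℝ) (g⁻¹ • x) :=
  (measurable_indicator_inv_smul hW).comp measurable_prodMk_left

variable {μ : Measure (G ⧸ Γ)} [IsProbabilityMeasure μ] [SMulInvariantMeasure G (G ⧸ Γ) μ]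

theorem integral_smear (h : IsTest E ψ) (hW : MeasurableSet W) :
    ∫ x, smear ν ψ W x ∂μ = (∫ g, ψ g ∂ν) * μ.real W := by
  have hint : Integrable (fun p : (G ⧸ Γ) × G =>
      ψ p.2 * W.indicator (1 : G ⧸ Γ → ℝ) (p.2⁻¹ • p.1)) (μ.prod ν) := by
    have h1 : Integrable (fun p : (G ⧸ Γ) × G => ψ p.2) (μ.prod ν) :=
      (h.integrable).comp_snd μ
    refine h1.mono (h1.aestronglyMeasurable.mul
      (measurable_indicator_inv_smul hW).aestronglyMeasurable) (ae_of_all _ fun p => ?_)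
    rw [norm_mul]
    exact mul_le_of_le_one_right (norm_nonneg _) (abs_indicator_one_le _)
  simp only [smear]
  rw [integral_integral_swap hint, ← integral_mul_const]
  refine integral_congr_ae (ae_of_all _ fun g => ?_)
  have h2 : (fun x : G ⧸ Γ => W.indicator (1 : G ⧸ Γ → ℝ) (g⁻¹ • x)) =
      ((g⁻¹ • ·) ⁻¹' W).indicator 1 := rfl
  have h3 : MeasurableSet ((g⁻¹ • · : G ⧸ Γ → G ⧸ Γ) ⁻¹' W) :=
    hW.preimage (measurable_const_smul g⁻¹)
  simp only [integral_const_mul]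
  rw [h2, integral_indicator_one h3, measureReal_def, measure_preimage_smul, measureReal_def]

/-- The bound `‖ψ * 1_W‖₂ ≤ ‖ψ‖₁ ‖1_W‖₂`. As `|ψ * 1_W|` is at most `|ψ| * 1_W ≤ ‖ψ‖₁`, one factor
of its square is bounded and the other is integrated by Tonelli's theorem. -/
theorem eLpNorm_smear_le (h : IsTest E ψ) (hW : MeasurableSet W) :
    eLpNorm (smear ν ψ W) 2 μ ≤ (∫⁻ g, ‖ψ g‖ₑ ∂ν) * μ W ^ (1 / 2 : ℝ) := by
  set M := ∫⁻ g, ‖ψ g‖ₑ ∂ν with hM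
  set L : G ⧸ Γ → ℝ≥0∞ := fun x => ∫⁻ g, ‖ψ g‖ₑ * W.indicator 1 (g⁻¹ • x) ∂ν with hL
  have hle : ∀ x, ‖smear ν ψ W x‖ₑ ≤ L x := fun x => by
    refine (enorm_integral_le_lintegral_enorm _).trans (lintegral_mono fun g => ?_)
    by_cases hg : g⁻¹ • x ∈ W <;> simp [hg]
  have hLM : ∀ x, L x ≤ M := fun x => lintegral_mono fun g => by
    by_cases hg : g⁻¹ • x ∈ W <;> simp [hg]
  have hmeas : Measurable fun p : (G ⧸ Γ) × G =>
      ‖ψ p.2‖ₑ * W.indicator (1 : G ⧸ Γ → ℝ≥0∞) (p.2⁻¹ • p.1) :=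
    (h.1.continuous.measurable.comp measurable_snd).enorm.mul
      ((measurable_one.indicator hW).comp
        measurable_inv_smul_fst)
  have hLint : ∫⁻ x, L x ∂μ = M * μ W := by
    rw [hL, lintegral_lintegral_swap hmeas.aemeasurable, hM,
      ← lintegral_mul_const _ h.1.continuous.measurable.enorm]
    refine lintegral_congr fun g => ?_
    have h3 : MeasurableSet ((g⁻¹ • · : G ⧸ Γ → G ⧸ Γ) ⁻¹' W) :=
      hW.preimage (measurable_const_smul g⁻¹)
    have h2 : (fun x : G ⧸ Γ => W.indicator (1 : G ⧸ Γ → ℝ≥0∞) (g⁻¹ • x)) =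
      ((g⁻¹ • ·) ⁻¹' W).indicator 1 := rfl
    rw [lintegral_const_mul' _ _ enorm_ne_top, h2, lintegral_indicator_one h3,
      measure_preimage_smul]
  have hMtop : M ≠ ⊤ := (h.integrable (ν := ν)).2.ne
  rw [eLpNorm_eq_lintegral_rpow_enorm_toReal (by simp) (by simp)]
  simp only [ENNReal.toReal_ofNat]
  calc (∫⁻ x, ‖smear ν ψ W x‖ₑ ^ (2 : ℝ) ∂μ) ^ (1 / 2 : ℝ)
      ≤ (∫⁻ x, M * L x ∂μ) ^ (1 / 2 : ℝ) := by
        gcongr with x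
        rw [ENNReal.rpow_two, sq]
        exact mul_le_mul' ((hle x).trans (hLM x)) (hle x)
    _ = (M ^ (2 : ℝ) * μ W) ^ (1 / 2 : ℝ) := by
        rw [lintegral_const_mul' _ _ hMtop, hLint, ENNReal.rpow_two, sq, mul_assoc]
    _ = M * μ W ^ (1 / 2 : ℝ) := by
        rw [ENNReal.mul_rpow_of_nonneg _ _ (by norm_num), ← ENNReal.rpow_mul]
        norm_num

end SmearMeasure

section SmearSmooth

variable {E : Type*} [NormedAddCommGroup E] [NormedSpace ℝ E] [FiniteDimensional ℝ E]
  {G : Type*} [TopologicalSpace G] [T2Space G] [SecondCountableTopology G]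
  [ChartedSpace E G] [Group G] [LieGroup 𝓘(ℝ, E) ∞ G] [IsTopologicalGroup G]
  [MeasurableSpace G] [BorelSpace G] {Γ : Subgroup G}
  [MeasurableSpace (G ⧸ Γ)] [BorelSpace (G ⧸ Γ)]
  {ν : Measure G} [IsFiniteMeasureOnCompacts ν] [ν.IsMulLeftInvariant]
  {ψ : G → ℝ} {W : Set (G ⧸ Γ)}

theorem isSmooth_smear (h : IsTest E ψ) (hW : MeasurableSet W) :
    IsSmooth (E := E) (smear ν ψ W) := by
  have h1 : (fun a : G => smear ν ψ W (a : G ⧸ Γ)) = fun a : G =>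
      ∫ g, ψ (a * g) * W.indicator (1 : G ⧸ Γ → ℝ) (g⁻¹ • ((1 : G) : G ⧸ Γ)) ∂ν := by
    funext a
    rw [← smear_smul, MulAction.Quotient.smul_coe, smul_eq_mul, mul_one]
  rw [IsSmooth, h1]
  exact h.contMDiff_integral (measurable_indicator_inv_smul_right hW _)
    fun g => abs_indicator_one_le _

theorem continuous_smear (h : IsTest E ψ) (hW : MeasurableSet W) : Continuous (smear ν ψ W) :=
  (QuotientGroup.isQuotientMap_mk (N := Γ)).continuous_iff.2 (isSmooth_smear h hW).continuous

/-- By left invariance of `ν`, differentiating `a ↦ (ψ * 1_W) (a x)` moves the derivative onto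
the smooth factor `ψ`. -/
theorem lieD_smear (h : IsTest E ψ) (hW : MeasurableSet W) (Y : GroupLieAlgebra 𝓘(ℝ, E) G) :
    lieD Y (smear ν ψ W) = smear ν (rightInvD Y ψ) W := by
  funext x
  have h1 : (fun a : G => smear ν ψ W (a • x)) = fun a : G =>
      ∫ g, ψ (a * g) * W.indicator (1 : G ⧸ Γ → ℝ) (g⁻¹ • x) ∂ν := funext fun a => smear_smul a
  rw [lieD, h1]
  exact h.mfderiv_integral (measurable_indicator_inv_smul_right hW x)
    (fun g => abs_indicator_one_le _) Y

variable {n : ℕ}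

theorem exists_multiD_smear (h : IsTest E ψ) (Y : Fin n → GroupLieAlgebra 𝓘(ℝ, E) G)
    (α : Fin n → ℕ) :
    ∃ ψ' : G → ℝ, IsTest E ψ' ∧ ∀ W : Set (G ⧸ Γ), MeasurableSet W →
      multiD Y α (smear ν ψ W) = smear ν ψ' W := by
  have hiter : ∀ (Y : GroupLieAlgebra 𝓘(ℝ, E) G) (k : ℕ) (ψ : G → ℝ), IsTest E ψ →
      ∃ ψ' : G → ℝ, IsTest E ψ' ∧ ∀ W : Set (G ⧸ Γ), MeasurableSet W →
        (lieD Y)^[k] (smear ν ψ W) = smear ν ψ' W := by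
    intro Y k
    induction k with
    | zero => exact fun ψ hψ => ⟨ψ, hψ, fun W _ => rfl⟩
    | succ k ih =>
      intro ψ hψ
      obtain ⟨ψ', hψ', h'⟩ := ih _ (hψ.rightInvD Y)
      refine ⟨ψ', hψ', fun W hW => ?_⟩
      rw [Function.iterate_succ_apply, lieD_smear hψ hW, h' W hW]
  unfold multiD
  induction List.finRange n with
  | nil => exact ⟨ψ, h, fun W _ => rfl⟩
  | cons i l ih =>
    obtain ⟨ψ₁, hψ₁, h₁⟩ := ih
    obtain ⟨ψ₂, hψ₂, h₂⟩ := hiter (Y i) (α i) ψ₁ hψ₁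
    refine ⟨ψ₂, hψ₂, fun W hW => ?_⟩
    rw [List.foldr_cons, h₁ W hW, h₂ W hW]

variable [SFinite ν] {μ : Measure (G ⧸ Γ)} [IsProbabilityMeasure μ]
  [SMulInvariantMeasure G (G ⧸ Γ) μ]

variable (ν μ) in
/-- The constant does not depend on `W`: every derivative of `ψ * 1_W` is a convolution of `1_W`
with a test function determined by `ψ`. -/
theorem exists_sobolevNorm_smear_le (h : IsTest E ψ) (Y : Fin n → GroupLieAlgebra 𝓘(ℝ, E) G)
    (l : ℕ) :
    ∃ C : ℝ≥0∞, C ≠ ⊤ ∧ ∀ W : Set (G ⧸ Γ), MeasurableSet W →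
      sobolevNorm μ Y l (smear ν ψ W) ≤ C * μ W ^ (1 / 2 : ℝ) := by
  choose ψ' hψ' h' using fun α => exists_multiD_smear (ν := ν) (Γ := Γ) h Y α
  refine ⟨∑ α ∈ (Fintype.piFinset fun _ : Fin n => Finset.range (l + 1)) with ∑ i, α i ≤ l,
    ∫⁻ g, ‖ψ' α g‖ₑ ∂ν, ?_, fun W hW => ?_⟩
  · exact ENNReal.sum_ne_top.2 fun α _ => ((hψ' α).integrable (ν := ν)).2.ne
  · rw [sobolevNorm, Finset.sum_mul]
    refine Finset.sum_le_sum fun α _ => ?_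
    rw [h' α W hW]
    exact eLpNorm_smear_le (hψ' α) hW

theorem smear_mem_cInftyTwo (h : IsTest E ψ) (Y : Fin n → GroupLieAlgebra 𝓘(ℝ, E) G)
    (hW : MeasurableSet W) : smear ν ψ W ∈ CInftyTwo μ Y := by
  refine ⟨isSmooth_smear h hW, fun l => ?_⟩
  obtain ⟨C, hC, hCW⟩ := exists_sobolevNorm_smear_le ν μ h Y l
  refine (hCW W hW).trans_lt (ENNReal.mul_lt_top hC.lt_top ?_)
  exact ENNReal.rpow_lt_top_of_nonneg (by norm_num) (measure_ne_top μ W)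

end SmearSmooth

/-! ### Growth of sums with controlled variance -/

section Growth

variable {X : Type*} [MeasurableSpace X] {μ : Measure X} {T : ℕ → X → ℝ} {s : ℕ → ℝ} {K : ℝ}

/-- If the variances of the variables `T N` grow at most linearly in their means `s N`, then they
are summable after division by `(s N)²` along a sequence on which `s` grows geometrically, so
`T N` is comparable to `s N` along this sequence. -/
theorem ae_eventually_abs_sub_le {N : ℕ → ℕ} (hN : ∀ k, 2 ^ k ≤ s (N k)) (hK : 0 ≤ K)
    (hint : ∀ n, Integrable (fun x => (T n x - s n) ^ 2) μ)
    (hvar : ∀ n, ∫ x, (T n x - s n) ^ 2 ∂μ ≤ K * s n) :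
    ∀ᵐ x ∂μ, ∀ᶠ k in atTop, |T (N k) x - s (N k)| ≤ s (N k) / 2 := by
  have hpos : ∀ k, 0 < s (N k) := fun k => (by positivity : (0 : ℝ) < 2 ^ k).trans_le (hN k)
  set g : ℕ → X → ℝ≥0∞ :=
    fun k x => ENNReal.ofReal ((T (N k) x - s (N k)) ^ 2 / s (N k) ^ 2) with hg
  have hgm : ∀ k, AEMeasurable (g k) μ := fun k =>
    ((hint (N k)).div_const _).aestronglyMeasurable.aemeasurable.ennreal_ofReal
  have hgle : ∀ k, ∫⁻ x, g k x ∂μ ≤ ENNReal.ofReal (K * (1 / 2) ^ k) := fun k => by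
    rw [hg, ← ofReal_integral_eq_lintegral_ofReal ((hint (N k)).div_const _)
      (ae_of_all _ fun x => by positivity)]
    refine ENNReal.ofReal_le_ofReal ?_
    rw [integral_div, div_le_iff₀ (by have := hpos k; positivity)]
    refine (hvar (N k)).trans ?_
    have h1 : (1 : ℝ) ≤ (1 / 2) ^ k * s (N k) := by
      calc (1 : ℝ) = (1 / 2) ^ k * 2 ^ k := by rw [← mul_pow]; norm_num
        _ ≤ _ := by gcongr; exact hN k
    calc K * s (N k) = K * 1 * s (N k) := by ring
      _ ≤ K * ((1 / 2) ^ k * s (N k)) * s (N k) := by have := (hpos k).le; gcongr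
      _ = _ := by ring
  have hsum : ∫⁻ x, ∑' k, g k x ∂μ ≠ ⊤ := by
    rw [lintegral_tsum hgm]
    refine ne_top_of_le_ne_top ?_ (ENNReal.tsum_le_tsum hgle)
    have hs : Summable fun k : ℕ => K * (1 / 2 : ℝ) ^ k :=
      (summable_geometric_of_lt_one (by norm_num) (by norm_num)).mul_left K
    rw [← ENNReal.ofReal_tsum_of_nonneg (fun k => by positivity) hs]
    exact ENNReal.ofReal_ne_top
  filter_upwards [ae_lt_top' (AEMeasurable.tsum hgm) hsum] with x hx
  have h0 := ENNReal.tendsto_atTop_zero_of_tsum_ne_top hx.ne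
  have hq : (0 : ℝ≥0∞) < ENNReal.ofReal (1 / 4) := by simp
  filter_upwards [h0.eventually (gt_mem_nhds hq)] with k hk
  have h2 : (T (N k) x - s (N k)) ^ 2 / s (N k) ^ 2 < 1 / 4 :=
    (ENNReal.ofReal_lt_ofReal_iff (by norm_num)).1 hk
  rw [div_lt_iff₀ (by have := hpos k; positivity)] at h2
  exact abs_le_of_sq_le_sq (by nlinarith) (by have := hpos k; positivity)

/-- Interpolation by monotonicity: the means have increments at most one, so they grow by a
bounded factor between consecutive times of `ae_eventually_abs_sub_le`. -/
theorem ae_eventually_comparable (hT : ∀ x, Monotone fun n => T n x) (hs : Monotone s)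
    (hs0 : s 0 = 0) (hs1 : ∀ n, s (n + 1) ≤ s n + 1) (hlim : Tendsto s atTop atTop) (hK : 0 ≤ K)
    (hint : ∀ n, Integrable (fun x => (T n x - s n) ^ 2) μ)
    (hvar : ∀ n, ∫ x, (T n x - s n) ^ 2 ∂μ ≤ K * s n) :
    ∀ᵐ x ∂μ, ∀ᶠ n in atTop, s n / 6 ≤ T n x ∧ T n x ≤ 6 * s n := by
  classical
  have hex : ∀ k : ℕ, ∃ n, (2 : ℝ) ^ k ≤ s n := fun k => (hlim.eventually_ge_atTop _).exists
  set N : ℕ → ℕ := fun k => Nat.find (hex k) with hNdef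
  have hN : ∀ k, 2 ^ k ≤ s (N k) := fun k => Nat.find_spec (hex k)
  have hN' : ∀ k, s (N k) ≤ 2 ^ k + 1 := fun k => by
    rcases Nat.eq_zero_or_pos (N k) with h | h
    · rw [h, hs0]; positivity
    · obtain ⟨j, hj⟩ := Nat.exists_eq_succ_of_ne_zero h.ne'
      have h1 : s j < 2 ^ k := not_le.1 (Nat.find_min (hex k) (m := j) (by
        change j < N k; omega))
      rw [hj]
      linarith [hs1 j]
  have hgrow : ∀ k, s (N (k + 1)) ≤ 3 * s (N k) := fun k => by
    have h1 : (1 : ℝ) ≤ 2 ^ k := one_le_pow₀ (by norm_num)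
    have h2 := hN' (k + 1)
    rw [pow_succ] at h2
    linarith [hN k]
  filter_upwards [ae_eventually_abs_sub_le hN hK hint hvar] with x hx
  obtain ⟨k₀, hk₀⟩ := eventually_atTop.1 hx
  filter_upwards [eventually_ge_atTop (N k₀)] with n hn
  -- Take the first `k ≥ k₀` with `n ≤ N (k + 1)`; it exists as `s (N k)` is unbounded.
  obtain ⟨k, hk, hkn, hnk⟩ : ∃ k ≥ k₀, N k ≤ n ∧ n ≤ N (k + 1) := by
    have hP : ∃ k, k₀ ≤ k ∧ n ≤ N (k + 1) := by
      obtain ⟨j, hj⟩ := pow_unbounded_of_one_lt (s n) (one_lt_two (α := ℝ))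
      refine ⟨max j k₀, le_max_right _ _, ?_⟩
      by_contra! hlt
      have h1 := hs hlt.le
      have h2 := hN (max j k₀ + 1)
      have h3 : (2 : ℝ) ^ j ≤ 2 ^ (max j k₀ + 1) :=
        pow_le_pow_right₀ (by norm_num) ((le_max_left _ _).trans (Nat.le_succ _))
      linarith
    obtain ⟨h1, h2⟩ := Nat.find_spec hP
    refine ⟨Nat.find hP, h1, ?_, h2⟩
    rcases h1.eq_or_lt with h | h
    · rwa [← h]
    · obtain ⟨j, hj⟩ := Nat.exists_eq_succ_of_ne_zero (by omega : Nat.find hP ≠ 0)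
      have h3 := Nat.find_min hP (m := j) (by omega)
      rw [hj]
      by_contra! hlt
      exact h3 ⟨by omega, hlt.le⟩
  have h1 := abs_le.1 (hk₀ k hk)
  have h2 := abs_le.1 (hk₀ (k + 1) (hk.trans (Nat.le_succ k)))
  have h3 := hT x hkn
  have h4 := hT x hnk
  have h5 := hs hkn
  have h6 := hs hnk
  have h7 := hgrow k
  have h8 : (0 : ℝ) < s (N k) := (by positivity : (0 : ℝ) < 2 ^ k).trans_le (hN k)
  simp only at h3 h4
  constructor <;> linarith

end Growth

section PartialSums

theorem icc_one_eq_map_range (N : ℕ+) :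
    Finset.Icc 1 N = (Finset.range N).map Equiv.pnatEquivNat.symm.toEmbedding := by
  ext t
  simp only [Finset.mem_Icc, one_le, true_and, Finset.mem_map, Finset.mem_range,
    Equiv.coe_toEmbedding]
  constructor
  · intro h
    refine ⟨t.natPred, ?_, Equiv.pnatEquivNat.symm_apply_apply t⟩
    have h1 := PNat.natPred_add_one t
    have h2 : (t : ℕ) ≤ N := h
    omega
  · rintro ⟨i, hi, rfl⟩
    exact PNat.coe_le_coe _ _ |>.1 (by simpa using hi)

theorem tendsto_sum_range_toReal {a : ℕ+ → ℝ≥0∞} (ha : ∀ t, a t ≠ ⊤) (hsum : ∑' t, a t = ⊤) :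
    Tendsto (fun n => ∑ i ∈ Finset.range n, (a (Equiv.pnatEquivNat.symm i)).toReal)
      atTop atTop := by
  rw [← Equiv.pnatEquivNat.symm.tsum_eq a] at hsum
  have h1 := ENNReal.tendsto_nat_tsum fun i => a (Equiv.pnatEquivNat.symm i)
  rw [hsum, ENNReal.tendsto_nhds_top_iff_nnreal] at h1
  refine tendsto_atTop.2 fun b => ?_
  filter_upwards [h1 b.toNNReal] with n hn
  rw [← ENNReal.toReal_sum fun i _ => ha _]
  refine (Real.le_coe_toNNReal b).trans ?_
  exact (ENNReal.toReal_mono (ENNReal.sum_ne_top.2 fun i _ => ha _) hn.le)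

end PartialSums

section Correlations

variable {X ι : Type*} [MeasurableSpace X] {μ : Measure X} [IsProbabilityMeasure μ]

/-- Almost orthogonality: if the covariances of the variables `u i`, `u j` are bounded by
`e i j * √(a i * a j)`, with `a` their means and `e` having bounded column sums, then the
variance of a sum is at most a multiple of its mean. This is Schur's test. -/
theorem integral_sum_sub_sq_le {u : ι → X → ℝ} {a : ι → ℝ} {e : ι → ι → ℝ} {K : ℝ}
    (hu : ∀ i, Measurable (u i)) (hu1 : ∀ i x, |u i x| ≤ 1) (ha : ∀ i, ∫ x, u i x ∂μ = a i)
    (ha0 : ∀ i, 0 ≤ a i) (he0 : ∀ i j, 0 ≤ e i j)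
    (he : ∀ i j, (∫ x, u i x * u j x ∂μ) - a i * a j ≤ e i j * √(a i * a j))
    (S : Finset ι) (hK : ∀ j, ∑ i ∈ S, e i j ≤ K) :
    Integrable (fun x => (∑ i ∈ S, u i x - ∑ i ∈ S, a i) ^ 2) μ ∧
      ∫ x, (∑ i ∈ S, u i x - ∑ i ∈ S, a i) ^ 2 ∂μ ≤ K * ∑ i ∈ S, a i := by
  have hbd : ∀ i, Integrable (u i) μ := fun i =>
    (integrable_const (1 : ℝ)).mono (hu i).aestronglyMeasurable
      (ae_of_all _ fun x => by simpa using hu1 i x)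
  have hprod : ∀ i j, Integrable (fun x => u i x * u j x) μ := fun i j =>
    (hbd i).mul_bdd (c := 1) (hu j).aestronglyMeasurable (ae_of_all _ fun x => hu1 j x)
  have hexp : ∀ i j, (fun x => (u i x - a i) * (u j x - a j)) =
      fun x => u i x * u j x - u i x * a j - a i * u j x + a i * a j := fun i j => by
    funext x; ring
  have hint₁ : ∀ i j, Integrable (fun x => u i x * u j x - u i x * a j) μ := fun i j =>
    (hprod i j).sub ((hbd i).mul_const (a j))
  have hint₂ : ∀ i j, Integrable (fun x => u i x * u j x - u i x * a j - a i * u j x) μ :=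
    fun i j => (hint₁ i j).sub ((hbd j).const_mul (a i))
  have hint : ∀ i j, Integrable (fun x => (u i x - a i) * (u j x - a j)) μ := fun i j => by
    rw [hexp]
    exact (hint₂ i j).add (integrable_const (a i * a j))
  have hcov : ∀ i j, ∫ x, (u i x - a i) * (u j x - a j) ∂μ =
      (∫ x, u i x * u j x ∂μ) - a i * a j := fun i j => by
    rw [hexp, integral_add (hint₂ i j) (integrable_const _),
      integral_sub (hint₁ i j) ((hbd j).const_mul (a i)),
      integral_sub (hprod i j) ((hbd i).mul_const (a j)), integral_mul_const,
      integral_const_mul, ha, ha]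
    simp
  have hsq : ∀ x, (∑ i ∈ S, u i x - ∑ i ∈ S, a i) ^ 2 =
      ∑ i ∈ S, ∑ j ∈ S, (u i x - a i) * (u j x - a j) := fun x => by
    rw [← Finset.sum_sub_distrib, sq, Finset.sum_mul_sum]
  have hterm : ∀ i j, (∫ x, u i x * u j x ∂μ) - a i * a j ≤
      (e j i * a i + e i j * a j) / 2 := fun i j => by
    have hsqrt : √(a i * a j) ≤ (a i + a j) / 2 := by
      rw [Real.sqrt_le_left (by have := ha0 i; have := ha0 j; positivity)]
      nlinarith [sq_nonneg (a i - a j)]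
    have h1 := (he i j).trans (mul_le_mul_of_nonneg_left hsqrt (he0 i j))
    have h2 : (∫ x, u i x * u j x ∂μ) - a i * a j ≤ e j i * ((a i + a j) / 2) := by
      have h3 := he j i
      simp only [mul_comm (u j _), mul_comm (a j)] at h3
      exact h3.trans (mul_le_mul_of_nonneg_left hsqrt (he0 j i))
    -- The covariance is symmetric, so both `e i j` and `e j i` bound it: use the smaller one.
    rcases le_total (e i j) (e j i) with h | h
    · nlinarith [mul_le_mul_of_nonneg_right h (ha0 i)]
    · nlinarith [mul_le_mul_of_nonneg_right h (ha0 j)]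
  simp_rw [hsq]
  refine ⟨integrable_finsetSum _ fun i _ => integrable_finsetSum _ fun j _ => hint i j, ?_⟩
  rw [integral_finsetSum _ fun i _ => integrable_finsetSum _ fun j _ => hint i j]
  simp_rw [integral_finsetSum _ fun j _ => hint _ j, hcov]
  calc ∑ i ∈ S, ∑ j ∈ S, ((∫ x, u i x * u j x ∂μ) - a i * a j)
      ≤ ∑ i ∈ S, ∑ j ∈ S, (e j i * a i + e i j * a j) / 2 :=
        Finset.sum_le_sum fun i _ => Finset.sum_le_sum fun j _ => hterm i j
    _ = ∑ j ∈ S, (∑ i ∈ S, e i j) * a j := by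
        simp_rw [add_div, Finset.sum_add_distrib, Finset.sum_mul]
        rw [Finset.sum_comm (s := S) (t := S) (f := fun i j => e i j * a j / 2),
          ← Finset.sum_add_distrib]
        refine Finset.sum_congr rfl fun j _ => ?_
        rw [← Finset.sum_add_distrib]
        exact Finset.sum_congr rfl fun i _ => by ring
    _ ≤ ∑ j ∈ S, K * a j :=
        Finset.sum_le_sum fun j _ => mul_le_mul_of_nonneg_right (hK j) (ha0 j)
    _ = K * ∑ i ∈ S, a i := by rw [Finset.mul_sum]

/-- Almost orthogonal variables with values in `[0, 1]` and divergent sum of means: their partial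
sums are almost surely comparable to the partial sums of the means. -/
theorem ae_eventually_sum_comparable {u : ℕ+ → X → ℝ} {a : ℕ+ → ℝ≥0∞} {e : ℕ+ → ℕ+ → ℝ} {K : ℝ}
    (hu : ∀ i, Measurable (u i)) (hu0 : ∀ i x, 0 ≤ u i x) (hu1 : ∀ i x, u i x ≤ 1)
    (ha : ∀ i, ∫ x, u i x ∂μ = (a i).toReal) (ha1 : ∀ i, a i ≤ 1) (he0 : ∀ i j, 0 ≤ e i j)
    (he : ∀ i j, (∫ x, u i x * u j x ∂μ) - (a i).toReal * (a j).toReal ≤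
      e i j * √((a i).toReal * (a j).toReal))
    (hK0 : 0 ≤ K) (hK : ∀ (S : Finset ℕ+) (j : ℕ+), ∑ i ∈ S, e i j ≤ K) (hsum : ∑' t, a t = ⊤) :
    ∀ᵐ x ∂μ, ∀ᶠ N : ℕ+ in atTop,
      (∑ t ∈ Finset.Icc 1 N, (a t).toReal) / 6 ≤ ∑ t ∈ Finset.Icc 1 N, u t x ∧
      ∑ t ∈ Finset.Icc 1 N, u t x ≤ 6 * ∑ t ∈ Finset.Icc 1 N, (a t).toReal := by
  have hvar := fun S : Finset ℕ+ => integral_sum_sub_sq_le (μ := μ) hu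
    (fun i x => by rw [abs_of_nonneg (hu0 i x)]; exact hu1 i x) ha
    (fun i => ENNReal.toReal_nonneg) he0 he S (hK S)
  have hmain := ae_eventually_comparable (μ := μ) (K := K)
    (T := fun k x => ∑ i ∈ Finset.range k, u (Equiv.pnatEquivNat.symm i) x)
    (s := fun k => ∑ i ∈ Finset.range k, (a (Equiv.pnatEquivNat.symm i)).toReal)
    (fun x => monotone_nat_of_le_succ fun k => by
      rw [Finset.sum_range_succ]
      exact le_add_of_nonneg_right (hu0 _ x))
    (monotone_nat_of_le_succ fun k => by
      rw [Finset.sum_range_succ]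
      exact le_add_of_nonneg_right ENNReal.toReal_nonneg)
    (by simp)
    (fun k => by
      rw [Finset.sum_range_succ]
      gcongr
      exact ENNReal.toReal_le_of_le_ofReal zero_le_one (by simpa using ha1 _))
    (tendsto_sum_range_toReal (fun t => ne_top_of_le_ne_top (by simp) (ha1 t)) hsum) hK0
    (fun k => by
      simpa only [Finset.sum_map, Equiv.coe_toEmbedding] using
        (hvar ((Finset.range k).map Equiv.pnatEquivNat.symm.toEmbedding)).1)
    (fun k => by
      simpa only [Finset.sum_map, Equiv.coe_toEmbedding] using
        (hvar ((Finset.range k).map Equiv.pnatEquivNat.symm.toEmbedding)).2)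
  filter_upwards [hmain] with x hx
  filter_upwards [tendsto_PNat_val_atTop_atTop.eventually hx] with N hN
  simpa only [icc_one_eq_map_range, Finset.sum_map, Equiv.coe_toEmbedding] using hN

end Correlations

/-! ### Sums of smoothed indicators along the sequence -/

theorem expNeg_ne_top (lam : ℝ) (d : ℝ≥0∞) : expNeg lam d ≠ ⊤ := by
  unfold expNeg
  split_ifs <;> simp

section Mixing

variable {E : Type*} [NormedAddCommGroup E] [NormedSpace ℝ E] [FiniteDimensional ℝ E]
  {G : Type*} [TopologicalSpace G] [T2Space G] [SecondCountableTopology G]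
  [ChartedSpace E G] [Group G] [LieGroup 𝓘(ℝ, E) ∞ G] [IsTopologicalGroup G]
  [MeasurableSpace G] [BorelSpace G] {Γ : Subgroup G}
  [MeasurableSpace (G ⧸ Γ)] [BorelSpace (G ⧸ Γ)]
  {μ : Measure (G ⧸ Γ)} [IsProbabilityMeasure μ] [SMulInvariantMeasure G (G ⧸ Γ) μ]
  {n : ℕ} {Y : Fin n → GroupLieAlgebra 𝓘(ℝ, E) G}
  {m : ContMDiffRiemannianMetric 𝓘(ℝ, E) ∞ E (fun x : G => TangentSpace 𝓘(ℝ, E) x)}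
  {ν : Measure G} [IsFiniteMeasureOnCompacts ν] [ν.IsMulLeftInvariant] [SFinite ν]
  {ψ : G → ℝ}

/-- The Sobolev norms of smoothed indicators are bounded by the square roots of their means, so
exponential mixing bounds their covariances by the geometric mean of the means. -/
theorem exists_correlation_smear_le (hmix : ExponentiallyMixing μ Y m) (hψ : IsTest E ψ)
    (hψ1 : ∫ g, ψ g ∂ν = 1) :
    ∃ lam C : ℝ, 0 < lam ∧ 0 ≤ C ∧ ∀ W W' : Set (G ⧸ Γ), MeasurableSet W → MeasurableSet W' →
      ∀ g : G, (∫ x, smear ν ψ W (g⁻¹ • x) * smear ν ψ W' x ∂μ) - μ.real W * μ.real W' ≤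
        C * (expNeg lam (gnorm m g)).toReal * √(μ.real W * μ.real W') := by
  obtain ⟨lam, C, l, hlam, hC, hmix⟩ := hmix
  obtain ⟨D, hD, hDW⟩ := exists_sobolevNorm_smear_le (Γ := Γ) ν μ hψ Y l
  refine ⟨lam, C * D.toReal ^ 2, hlam, by positivity, fun W W' hW hW' g => ?_⟩
  have h1 := hmix _ (smear_mem_cInftyTwo (ν := ν) hψ Y hW) _
    (smear_mem_cInftyTwo (ν := ν) hψ Y hW') g
  rw [integral_smear hψ hW, integral_smear hψ hW', hψ1, one_mul, one_mul] at h1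
  have h2 := h1.trans (mul_le_mul' (mul_le_mul' le_rfl (hDW W hW)) (hDW W' hW'))
  have hfin : ∀ W : Set (G ⧸ Γ), μ W ^ (1 / 2 : ℝ) ≠ ⊤ := fun W =>
    (ENNReal.rpow_lt_top_of_nonneg (by norm_num) (measure_ne_top μ W)).ne
  have h3 := ENNReal.toReal_mono (by finiteness [expNeg_ne_top lam (gnorm m g), hfin W, hfin W'])
    h2
  rw [ENNReal.toReal_ofReal (abs_nonneg _)] at h3
  refine (le_abs_self _).trans (h3.trans (le_of_eq ?_))
  simp only [ENNReal.toReal_mul, ENNReal.toReal_ofReal hC.le, ← ENNReal.toReal_rpow,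
    ← measureReal_def, ← Real.sqrt_eq_rpow]
  rw [Real.sqrt_mul measureReal_nonneg]
  ring

/-- Along an exponentially divergent sequence, the sums of smoothed indicators of sets of
divergent total measure are almost surely comparable to their means. -/
theorem ae_eventually_sum_smear_comparable (hmix : ExponentiallyMixing μ Y m) {f : ℕ+ → G}
    (hf : ExponentiallyDivergent m f) (hψ : IsTest E ψ) (hψ0 : ∀ g, 0 ≤ ψ g)
    (hψ1 : ∫ g, ψ g ∂ν = 1) {W : ℕ+ → Set (G ⧸ Γ)} (hW : ∀ t, MeasurableSet (W t))
    (hsum : ∑' t, μ (W t) = ⊤) :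
    ∀ᵐ x ∂μ, ∀ᶠ N : ℕ+ in atTop,
      (∑ t ∈ Finset.Icc 1 N, μ.real (W t)) / 6 ≤
        ∑ t ∈ Finset.Icc 1 N, smear ν ψ (W t) (f t • x) ∧
      ∑ t ∈ Finset.Icc 1 N, smear ν ψ (W t) (f t • x) ≤
        6 * ∑ t ∈ Finset.Icc 1 N, μ.real (W t) := by
  obtain ⟨lam, C, hlam, hC, hcorr⟩ := exists_correlation_smear_le (ν := ν) hmix hψ hψ1
  have hBtop := (hf lam hlam).ne
  set B : ℝ≥0∞ := ⨆ t : ℕ+, ∑' s : ℕ+, expNeg lam (gnorm m (f s * (f t)⁻¹))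
  refine ae_eventually_sum_comparable (μ := μ) (K := C * B.toReal)
    (u := fun t x => smear ν ψ (W t) (f t • x)) (a := fun t => μ (W t))
    (e := fun i j => C * (expNeg lam (gnorm m (f i * (f j)⁻¹))).toReal)
    (fun i => (continuous_smear hψ (hW i)).measurable.comp (measurable_const_smul (f i)))
    (fun i x => smear_nonneg hψ0) (fun i x => smear_le_one hψ0 hψ1) (fun i => ?_)
    (fun i => prob_le_one) (fun i j => mul_nonneg hC ENNReal.toReal_nonneg) (fun i j => ?_)
    (mul_nonneg hC ENNReal.toReal_nonneg) (fun S j => ?_) hsum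
  · refine (integral_smul_eq_self (μ := μ) (smear ν ψ (W i)) (g := f i)).trans ?_
    rw [integral_smear hψ (hW i), hψ1, one_mul, measureReal_def]
  · have h1 := hcorr (W j) (W i) (hW j) (hW i) (f i * (f j)⁻¹)
    have h2 := integral_smul_eq_self (μ := μ) (fun x => smear ν ψ (W j)
      ((f i * (f j)⁻¹)⁻¹ • x) * smear ν ψ (W i) x) (g := f i)
    rw [← h2, mul_comm (μ.real (W j))] at h1
    simpa [measureReal_def, ← mul_smul, mul_comm (smear ν ψ (W j) _)] using h1
  · rw [← Finset.mul_sum, ← ENNReal.toReal_sum fun i _ => expNeg_ne_top _ _]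
    gcongr
    exact (ENNReal.sum_le_tsum S).trans
      (le_iSup (fun t : ℕ+ => ∑' s : ℕ+, expNeg lam (gnorm m (f s * (f t)⁻¹))) j)

end Mixing

/-! ### Distance-like functions -/

section DistanceLike

open scoped Pointwise

variable {G : Type*} [TopologicalSpace G] [Group G] [IsTopologicalGroup G] {Γ : Subgroup G}

theorem isOpen_smul_set {U : Set G} (hU : IsOpen U) (A : Set (G ⧸ Γ)) : IsOpen (U • A) := by
  have h1 : U • A = ⋃ x ∈ A, (fun g : G => g • x) '' U := by
    ext y
    simp only [Set.mem_smul, mem_iUnion, mem_image, exists_prop]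
    exact ⟨fun ⟨u, hu, x, hx, h⟩ => ⟨x, hx, u, hu, h⟩, fun ⟨x, hx, u, hu, h⟩ => ⟨u, hu, x, hx, h⟩⟩
  rw [h1]
  refine isOpen_biUnion fun x _ => ?_
  obtain ⟨a, rfl⟩ := QuotientGroup.mk_surjective x
  exact (QuotientGroup.isOpenMap_coe.comp (isOpenMap_mul_right a)) U hU

theorem exists_isOpen_symm_mul_subset {V : Set G} (hV : V ∈ 𝓝 (1 : G)) :
    ∃ U : Set G, IsOpen U ∧ (1 : G) ∈ U ∧ (∀ g ∈ U, g⁻¹ ∈ U) ∧ ∀ g ∈ U, ∀ h ∈ U, g * h ∈ V := by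
  obtain ⟨U, hU, hU1, hUV⟩ := exists_open_nhds_one_mul_subset hV
  refine ⟨U ∩ U⁻¹, hU.inter hU.inv, ⟨hU1, by simpa using hU1⟩,
    fun g hg => ⟨hg.2, by simpa using hg.1⟩, fun g hg h hh => hUV (mul_mem_mul hg.1 hh.1)⟩

end DistanceLike

section Counting

open scoped Pointwise

variable {E : Type*} [NormedAddCommGroup E] [NormedSpace ℝ E] [FiniteDimensional ℝ E]
  {G : Type*} [TopologicalSpace G] [T2Space G] [SecondCountableTopology G]
  [ChartedSpace E G] [Group G] [LieGroup 𝓘(ℝ, E) ∞ G] {Γ : Subgroup G}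
  [MeasurableSpace (G ⧸ Γ)] [BorelSpace (G ⧸ Γ)]
  {μ : Measure (G ⧸ Γ)} [IsProbabilityMeasure μ] [SMulInvariantMeasure G (G ⧸ Γ) μ]
  {n : ℕ} {Y : Fin n → GroupLieAlgebra 𝓘(ℝ, E) G}
  {m : ContMDiffRiemannianMetric 𝓘(ℝ, E) ∞ E (fun x : G => TangentSpace 𝓘(ℝ, E) x)}
  {f : ℕ+ → G} {Δ : G ⧸ Γ → ℝ} {z₀ : ℝ}

/-- The number of visits to the superlevel sets is comparable to the sum of their measures. With
`A z = {Δ ≥ z}` and a small neighbourhood `U` of the identity, the open sets `U • A z` and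
`U • A (z + δ)` have measures comparable to that of `A z`, while their smoothed indicators are a
majorant and a minorant of the indicator of `A z`. Working with these open sets makes the
measurability of `A z` irrelevant. -/
theorem exists_ae_eventually_count_comparable (hmix : ExponentiallyMixing μ Y m)
    (hf : ExponentiallyDivergent m f) (hΔ : IsDL μ Δ z₀) {r : ℕ+ → ℝ} (hr : ∀ t, z₀ ≤ r t)
    (hsum : ∑' t, μ (superLevel Δ (r t)) = ⊤) :
    ∃ c : ℝ, 0 < c ∧ c ≤ 1 ∧ ∀ᵐ x ∂μ, ∀ᶠ N : ℕ+ in atTop,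
      c * ∑ t ∈ Finset.Icc 1 N, μ.real (superLevel Δ (r t)) ≤
        ∑ t ∈ Finset.Icc 1 N, (superLevel Δ (r t)).indicator 1 (f t • x) ∧
      ∑ t ∈ Finset.Icc 1 N, (superLevel Δ (r t)).indicator 1 (f t • x) ≤
        1 / c * ∑ t ∈ Finset.Icc 1 N, μ.real (superLevel Δ (r t)) := by
  have : IsTopologicalGroup G := topologicalGroup_of_lieGroup 𝓘(ℝ, E) ∞
  have : LocallyCompactSpace G := Manifold.locallyCompact_of_finiteDimensional 𝓘(ℝ, E)
  let : MeasurableSpace G := borel G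
  have : BorelSpace G := ⟨rfl⟩
  set ν : Measure G := Measure.haar
  obtain ⟨-, hΔcont, c, δ, hc, hδ, hΔμ⟩ := hΔ
  obtain ⟨V, hV, hΔV⟩ := hΔcont δ hδ
  obtain ⟨U, hUo, hU1, hUinv, hUV⟩ := exists_isOpen_symm_mul_subset hV
  have hUV' : ∀ g ∈ U, g ∈ V := fun g hg => by simpa using hUV g hg 1 hU1
  obtain ⟨ψ, hψ, hψ0, hψ1, hψU⟩ := exists_mollifier (E := E) ν (hUo.mem_nhds hU1)
  have hmeas : ∀ z, MeasurableSet (U • superLevel Δ z) := fun z =>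
    (isOpen_smul_set hUo _).measurableSet
  have hsub : ∀ z, superLevel Δ z ⊆ U • superLevel Δ z := fun z x hx =>
    ⟨1, hU1, x, hx, one_smul G x⟩
  have hμup : ∀ t, c * μ.real (U • superLevel Δ (r t)) ≤ μ.real (superLevel Δ (r t)) :=
    fun t => by
      have h1 : U • superLevel Δ (r t) ⊆ superLevel Δ (r t - δ) := by
        rintro _ ⟨u, hu, x, hx, rfl⟩
        have h2 := abs_lt.1 (hΔV x ((hr t).trans hx) u (hUV' u hu))
        have h3 : r t ≤ Δ x := hx
        change r t - δ ≤ Δ (u • x)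
        linarith
      have h2 := ENNReal.toReal_mono (measure_ne_top μ _)
        ((mul_le_mul_right (measure_mono h1) _).trans (hΔμ (r t) (hr t)))
      rwa [ENNReal.toReal_mul, ENNReal.toReal_ofReal hc.le] at h2
  have hμlow : ∀ t, ENNReal.ofReal c * μ (superLevel Δ (r t)) ≤
      μ (U • superLevel Δ (r t + δ)) := fun t => by
    have h1 := hΔμ (r t + δ) (by have := hr t; linarith)
    rw [add_sub_cancel_right] at h1
    exact h1.trans (measure_mono (hsub _))
  have hind : ∀ z x, 0 ≤ (superLevel Δ z).indicator (1 : G ⧸ Γ → ℝ) x := fun z x =>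
    indicator_nonneg (by simp) x
  have hup : ∀ t x, (superLevel Δ (r t)).indicator 1 x ≤
      smear ν ψ (U • superLevel Δ (r t)) x := fun t x => by
    by_cases hx : x ∈ superLevel Δ (r t)
    · rw [indicator_of_mem hx]
      exact (smear_eq_one hψ1 fun g hg => smul_mem_smul (hUinv g (hψU g hg)) hx).ge
    · rw [indicator_of_notMem hx]
      exact smear_nonneg hψ0
  have hlow : ∀ t x, smear ν ψ (U • superLevel Δ (r t + δ)) x ≤
      (superLevel Δ (r t)).indicator 1 x := fun t x => by
    by_cases hx : x ∈ superLevel Δ (r t)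
    · rw [indicator_of_mem hx]
      exact smear_le_one hψ0 hψ1
    · refine (smear_eq_zero fun g hg => ?_).trans_le (hind _ _)
      rintro ⟨u, hu, y, hy, h⟩
      have h1 : x = (g * u) • y := by
        change u • y = g⁻¹ • x at h
        rw [mul_smul, h, smul_inv_smul]
      have h2 : r t + δ ≤ Δ y := hy
      have h3 := abs_lt.1 (hΔV y (by have := hr t; linarith) (g * u) (hUV g (hψU g hg) u hu))
      rw [← h1] at h3
      exact hx (show r t ≤ Δ x by linarith)
  have hsup : ∑' t, μ (U • superLevel Δ (r t)) = ⊤ :=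
    top_unique (hsum ▸ ENNReal.tsum_le_tsum fun t => measure_mono (hsub _))
  have hslow : ∑' t, μ (U • superLevel Δ (r t + δ)) = ⊤ := by
    refine top_unique (le_trans ?_ (ENNReal.tsum_le_tsum hμlow))
    rw [ENNReal.tsum_mul_left, hsum, ENNReal.mul_top (by simpa using hc)]
  have hc0 : 0 < min c 1 := lt_min hc one_pos
  refine ⟨min c 1 / 6, by positivity, by linarith [min_le_right c 1], ?_⟩
  filter_upwards [ae_eventually_sum_smear_comparable hmix hf hψ hψ0 hψ1 (fun t => hmeas (r t)) hsup,
    ae_eventually_sum_smear_comparable hmix hf hψ hψ0 hψ1 (fun t => hmeas (r t + δ)) hslow]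
    with x hx hx'
  filter_upwards [hx, hx'] with N hN hN'
  have hS : 0 ≤ ∑ t ∈ Finset.Icc 1 N, μ.real (superLevel Δ (r t)) :=
    Finset.sum_nonneg fun t _ => measureReal_nonneg
  have hW : 0 ≤ ∑ t ∈ Finset.Icc 1 N, μ.real (U • superLevel Δ (r t)) :=
    Finset.sum_nonneg fun t _ => measureReal_nonneg
  constructor
  · have h1 : c * ∑ t ∈ Finset.Icc 1 N, μ.real (superLevel Δ (r t)) ≤
        ∑ t ∈ Finset.Icc 1 N, μ.real (U • superLevel Δ (r t + δ)) := by
      rw [Finset.mul_sum]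
      refine Finset.sum_le_sum fun t _ => ?_
      have h2 := ENNReal.toReal_mono (measure_ne_top μ _) (hμlow t)
      rwa [ENNReal.toReal_mul, ENNReal.toReal_ofReal hc.le] at h2
    have h2 := Finset.sum_le_sum fun t (_ : t ∈ Finset.Icc 1 N) => hlow t (f t • x)
    have h3 := mul_le_mul_of_nonneg_right (min_le_left c 1) hS
    linarith [hN'.1]
  · have h1 : c * ∑ t ∈ Finset.Icc 1 N, μ.real (U • superLevel Δ (r t)) ≤
        ∑ t ∈ Finset.Icc 1 N, μ.real (superLevel Δ (r t)) := by
      rw [Finset.mul_sum]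
      exact Finset.sum_le_sum fun t _ => hμup t
    have h2 := Finset.sum_le_sum fun t (_ : t ∈ Finset.Icc 1 N) => hup t (f t • x)
    have h3 := mul_le_mul_of_nonneg_right (min_le_left c 1) hW
    rw [one_div_div, div_mul_eq_mul_div, le_div_iff₀ hc0]
    nlinarith [mul_le_mul_of_nonneg_right (h2.trans hN.2) hc0.le]

end Counting

/-! ### Counting visits -/

section Visits

variable {G : Type*} [Group G] {Γ : Subgroup G} {Δ : G ⧸ Γ → ℝ} {f : ℕ+ → G} {r : ℕ+ → ℝ}

theorem sum_indicator_superLevel (x : G ⧸ Γ) (N : ℕ+) :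
    ∑ t ∈ Finset.Icc 1 N, (superLevel Δ (r t)).indicator (1 : G ⧸ Γ → ℝ) (f t • x) =
      ({t : ℕ+ | t ≤ N ∧ r t ≤ Δ (f t • x)}.ncard : ℝ) := by
  classical
  have h1 : {t : ℕ+ | t ≤ N ∧ r t ≤ Δ (f t • x)} =
      ((Finset.Icc 1 N).filter fun t => r t ≤ Δ (f t • x) : Finset ℕ+) := by
    ext t; simp
  rw [h1, ncard_coe_finset, Finset.card_filter]
  push_cast
  exact Finset.sum_congr rfl fun t _ => by simp [indicator_apply, superLevel]

theorem infinite_visits {x : G ⧸ Γ} {c : ℝ} {S : ℕ+ → ℝ} (hc : 0 < c)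
    (hS : Tendsto S atTop atTop)
    (h : ∀ᶠ N : ℕ+ in atTop, c * S N ≤
      ∑ t ∈ Finset.Icc 1 N, (superLevel Δ (r t)).indicator (1 : G ⧸ Γ → ℝ) (f t • x)) :
    {t : ℕ+ | r t ≤ Δ (f t • x)}.Infinite := by
  intro hfin
  obtain ⟨N, hN, hN'⟩ := (h.and ((hS.const_mul_atTop hc).eventually_gt_atTop
    ({t : ℕ+ | r t ≤ Δ (f t • x)}.ncard : ℝ))).exists
  rw [sum_indicator_superLevel] at hN
  have h1 : {t : ℕ+ | t ≤ N ∧ r t ≤ Δ (f t • x)}.ncard ≤ {t : ℕ+ | r t ≤ Δ (f t • x)}.ncard :=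
    ncard_le_ncard (fun t ht => ht.2) hfin
  have h2 : ({t : ℕ+ | t ≤ N ∧ r t ≤ Δ (f t • x)}.ncard : ℝ) ≤
    {t : ℕ+ | r t ≤ Δ (f t • x)}.ncard := by exact_mod_cast h1
  linarith

variable [MeasurableSpace (G ⧸ Γ)] {μ : Measure (G ⧸ Γ)}

theorem tendsto_sum_superLevel [IsFiniteMeasure μ] (hsum : ∑' t, μ (superLevel Δ (r t)) = ⊤) :
    Tendsto (fun N : ℕ+ => ∑ t ∈ Finset.Icc 1 N, μ.real (superLevel Δ (r t))) atTop atTop := by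
  refine ((tendsto_sum_range_toReal (fun t => measure_ne_top μ _) hsum).comp
    tendsto_PNat_val_atTop_atTop).congr fun N => ?_
  simp only [icc_one_eq_map_range, Finset.sum_map, Equiv.coe_toEmbedding, Function.comp]
  rfl

theorem excursionRatio_eq_ofReal [IsFiniteMeasure μ] (x : G ⧸ Γ) {N : ℕ+}
    (hN : 0 < ∑ t ∈ Finset.Icc 1 N, μ.real (superLevel Δ (r t))) :
    excursionRatio μ Δ f r x N = ENNReal.ofReal
      ((∑ t ∈ Finset.Icc 1 N, (superLevel Δ (r t)).indicator (1 : G ⧸ Γ → ℝ) (f t • x)) /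
        ∑ t ∈ Finset.Icc 1 N, μ.real (superLevel Δ (r t))) := by
  rw [ENNReal.ofReal_div_of_pos hN, sum_indicator_superLevel, ENNReal.ofReal_natCast,
    ENNReal.ofReal_sum_of_nonneg fun t _ => measureReal_nonneg, excursionRatio]
  simp

/-- Raising the thresholds to `z₀` keeps the sum of the measures divergent: if infinitely many
thresholds are raised, the new sum has infinitely many terms equal to `μ {Δ ≥ z₀} > 0`. -/
theorem tsum_superLevel_max_eq_top [IsFiniteMeasure μ] {z₀ : ℝ} (h₀ : 0 < μ (superLevel Δ z₀))
    (hsum : ∑' t, μ (superLevel Δ (r t)) = ⊤) :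
    ∑' t, μ (superLevel Δ (max (r t) z₀)) = ⊤ := by
  by_contra hne
  have h1 := ENNReal.tendsto_cofinite_zero_of_tsum_ne_top hne
  have h2 : ∀ᶠ t in cofinite, z₀ ≤ r t := by
    filter_upwards [h1.eventually (gt_mem_nhds h₀)] with t ht
    by_contra! hlt
    rw [max_eq_right hlt.le] at ht
    exact lt_irrefl _ ht
  have hfin : {t | ¬ z₀ ≤ r t}.Finite := h2
  have h3 : ∀ t, μ (superLevel Δ (r t)) ≤ μ (superLevel Δ (max (r t) z₀)) +
      {t | ¬ z₀ ≤ r t}.indicator (fun t => μ (superLevel Δ (r t))) t := fun t => by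
    by_cases ht : z₀ ≤ r t
    · rw [max_eq_left ht]
      exact le_self_add
    · rw [indicator_of_mem (s := {t | ¬ z₀ ≤ r t}) ht]
      exact le_add_self
  have h4 := ENNReal.tsum_le_tsum h3
  rw [hsum, ENNReal.tsum_add] at h4
  refine (ENNReal.add_ne_top.2 ⟨hne, ?_⟩) (top_unique h4)
  rw [tsum_eq_sum (s := hfin.toFinset) fun t ht => by
    rw [indicator_of_notMem]; simpa using ht]
  exact ENNReal.sum_ne_top.2 fun t _ => ne_top_of_le_ne_top (measure_ne_top μ _)
    (indicator_le_self _ _ _)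

end Visits

end HomogeneousDynamics

theorem theorem1p3
    {E : Type*} [NormedAddCommGroup E] [NormedSpace ℝ E] [FiniteDimensional ℝ E]
    {G : Type*} [TopologicalSpace G] [T2Space G] [SecondCountableTopology G]
    [ChartedSpace E G] [Group G] [LieGroup 𝓘(ℝ, E) ∞ G]
    (Γ : Subgroup G) [DiscreteTopology Γ]
    [MeasurableSpace (G ⧸ Γ)] [BorelSpace (G ⧸ Γ)]
    (μ : Measure (G ⧸ Γ)) [IsProbabilityMeasure μ] [SMulInvariantMeasure G (G ⧸ Γ) μ]
    {n : ℕ} (Y : Module.Basis (Fin n) ℝ (GroupLieAlgebra 𝓘(ℝ, E) G))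
    (m : ContMDiffRiemannianMetric 𝓘(ℝ, E) ∞ E (fun x : G => TangentSpace 𝓘(ℝ, E) x))
    (hm : HomogeneousDynamics.IsRightInvariant m)
    (hmix : HomogeneousDynamics.ExponentiallyMixing μ Y m)
    (f : ℕ+ → G) (hf : HomogeneousDynamics.ExponentiallyDivergent m f)
    (Δ : G ⧸ Γ → ℝ) (z₀ : ℝ) (hΔ : HomogeneousDynamics.IsDL μ Δ z₀) :
    (∀ r : ℕ+ → ℝ, (∀ t, z₀ ≤ r t) →
      ∑' t, μ (HomogeneousDynamics.superLevel Δ (r t)) = ⊤ →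
      ∃ c : ℝ, 0 < c ∧ c ≤ 1 ∧ ∀ᵐ x ∂μ,
        ENNReal.ofReal c ≤
          liminf (fun N : ℕ+ => HomogeneousDynamics.excursionRatio μ Δ f r x N) atTop ∧
        limsup (fun N : ℕ+ => HomogeneousDynamics.excursionRatio μ Δ f r x N) atTop ≤
          ENNReal.ofReal (1 / c)) ∧
    (∀ r : ℕ+ → ℝ, ∑' t, μ (HomogeneousDynamics.superLevel Δ (r t)) = ⊤ →
      ∀ᵐ x ∂μ, {t : ℕ+ | r t ≤ Δ (f t • x)}.Infinite) ∧
    HomogeneousDynamics.IsBorelCantelli μ f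
      (range fun z : ℝ => HomogeneousDynamics.superLevel Δ z) := by
  have hinf : ∀ r : ℕ+ → ℝ, ∑' t, μ (HomogeneousDynamics.superLevel Δ (r t)) = ⊤ →
      ∀ᵐ x ∂μ, {t : ℕ+ | r t ≤ Δ (f t • x)}.Infinite := fun r hr => by
    have hr' := HomogeneousDynamics.tsum_superLevel_max_eq_top hΔ.1 hr
    obtain ⟨c, hc, -, hcx⟩ :=
      HomogeneousDynamics.exists_ae_eventually_count_comparable hmix hf hΔ
        (fun t => le_max_right (r t) z₀) hr'
    filter_upwards [hcx] with x hx
    refine (HomogeneousDynamics.infinite_visits hc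
      (HomogeneousDynamics.tendsto_sum_superLevel hr') (hx.mono fun N hN => hN.1)).mono ?_
    exact fun t ht => (le_max_left (r t) z₀).trans ht
  refine ⟨fun r hr hsum => ?_, hinf, fun A hA => ?_⟩
  · obtain ⟨c, hc, hc1, hcx⟩ :=
      HomogeneousDynamics.exists_ae_eventually_count_comparable hmix hf hΔ hr hsum
    refine ⟨c, hc, hc1, ?_⟩
    filter_upwards [hcx] with x hx
    have hpos := (HomogeneousDynamics.tendsto_sum_superLevel hsum).eventually_gt_atTop 0
    have hratio := hx.and hpos
    constructor
    · refine le_liminf_of_le (by isBoundedDefault) (hratio.mono fun N hN => ?_)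
      rw [HomogeneousDynamics.excursionRatio_eq_ofReal x hN.2]
      exact ENNReal.ofReal_le_ofReal ((le_div_iff₀ hN.2).2 hN.1.1)
    · refine limsup_le_of_le (by isBoundedDefault) (hratio.mono fun N hN => ?_)
      rw [HomogeneousDynamics.excursionRatio_eq_ofReal x hN.2]
      exact ENNReal.ofReal_le_ofReal ((div_le_iff₀ hN.2).2 hN.1.2)
  · choose r hr using hA
    obtain rfl : (fun t => HomogeneousDynamics.superLevel Δ (r t)) = A := funext hr
    refine ⟨fun hsum => ?_, hinf r⟩
    have hpre : ∑' t, μ ((f t • ·) ⁻¹' HomogeneousDynamics.superLevel Δ (r t)) ≠ ⊤ := by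
      simpa only [measure_preimage_smul] using hsum.ne
    filter_upwards [ae_finite_setOfPred_mem hpre] with x hx
    exact not_infinite.2 hx
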